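/- Let $M$ be a finite-dimensional smooth manifold (Hausdorff, $\sigma$-compact), let $\mu$ be a Borel measure on $M$ that is finite on compact sets (for instance a smooth measure), and let $L$ be a smooth second order diffusion operator on $M$ with real coefficients and $L1=0$, that is, a linear operator on $C^\infty(M)$ whose carré du champ $$\Gamma(f,g)=\tfrac12\{L(fg)-fLg-gLf\}$$ is a derivation in each argument and satisfies $\Gamma(f):=\Gamma(f,f)\ge 0$. Assume that $$\int_M fLg\,d\mu=\int_M gLf\,d\mu,\qquad \int_M fLf\,d\mu\le 0\qquad (f,g\in C_c^\infty(M)).$$ Let $$d(x,y)=\sup\{|f(x)-f(y)|:\ f\in C^\infty(M),\ \Gamma(f)\le 1\}\in[0,\infty].$$ Let $(P_t)_{t\ge 0}$ be the semigroup on $L^2(M,\mu)$ associated to $L$, i.e. $P_t=e^{tL}$, where $L$ also denotes the self-adjoint generator of the closure of the form $-\int_M fLg\,d\mu$ on $C_c^\infty(M)$ (it is the unique self-adjoint extension of $L$ whenever $L$ is essentially self-adjoint on $C_c^\infty(M)$). For $f\in L^\infty(M)$ with $f\ge 0$, let $P_tf$ be the increasing limit of $P_t(f\mathbf 1_{K_n})$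 along an exhaustion of $M$ by compact sets $K_n$. Let $x\in M$, $T>0$, $p>1$, $q=\frac{p}{2(p-1)}$ and $$\eta(s,y)=-\frac{d(x,y)^2}{2(T-qs)},\qquad y\in M,\ s<\frac Tq .$$ Then, for every $f\in L^\infty(M)$ with $f\ge 0$ and every $0\le t<\frac Tq$, $$\int_M (P_tf)^p(y)\,e^{\eta(t,y)}\,d\mu(y)\le\int_M f(y)^p\,e^{-\frac{d(x,y)^2}{2T}}\,d\mu(y)$$ in $[0,\infty]$, with $e^{-\infty}=0$. -/

import Mathlib

open MeasureTheory Filter Topology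
open scoped Manifold ContDiff ENNReal NNReal

/-- The carré du champ `Γ(f,g) = (L(fg) - f L g - g L f) / 2` of an operator `L` on `C^∞(M)`. -/
noncomputable def carreDuChamp {E : Type*} [NormedAddCommGroup E] [NormedSpace ℝ E]
    {M : Type*} [TopologicalSpace M] [ChartedSpace E M]
    (L : C^∞⟮𝓘(ℝ, E), M; ℝ⟯ →ₗ[ℝ] C^∞⟮𝓘(ℝ, E), M; ℝ⟯) (f g : C^∞⟮𝓘(ℝ, E), M; ℝ⟯) :
    C^∞⟮𝓘(ℝ, E), M; ℝ⟯ :=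
  (1 / 2 : ℝ) • (L (f * g) - f * L g - g * L f)

/-- A smooth second order diffusion operator `L` on the manifold `M`, with real coefficients, no
zeroth order term, symmetric and nonpositive on `C_c^∞(M)` with respect to the measure `μ`.

That `L` is a differential operator of order at most two with `L 1 = 0` is expressed, without
coordinates, by the fact that its carré du champ is a derivation in each argument (it is symmetric):
in a chart this says `L = ∑ a^{ij} ∂_i ∂_j + ∑ b^i ∂_i` with smooth `a^{ij} = a^{ji}`, `b^i`.  That `L`
is a diffusion operator (`(a^{ij})` is positive semidefinite) is `Γ(f,f) ≥ 0`. -/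
structure SymmetricDiffusion (E : Type*) [NormedAddCommGroup E] [NormedSpace ℝ E]
    {M : Type*} [TopologicalSpace M] [ChartedSpace E M] [MeasurableSpace M] (μ : Measure M) where
  /-- the operator -/
  L : C^∞⟮𝓘(ℝ, E), M; ℝ⟯ →ₗ[ℝ] C^∞⟮𝓘(ℝ, E), M; ℝ⟯
  map_one : L 1 = 0
  leibniz : ∀ f g h : C^∞⟮𝓘(ℝ, E), M; ℝ⟯,
    carreDuChamp L (f * g) h = f * carreDuChamp L g h + g * carreDuChamp L f h
  carreDuChamp_nonneg : ∀ (f : C^∞⟮𝓘(ℝ, E), M; ℝ⟯) (z : M), 0 ≤ carreDuChamp L f f z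
  symm : ∀ f g : C^∞⟮𝓘(ℝ, E), M; ℝ⟯, HasCompactSupport f → HasCompactSupport g →
    ∫ z, f z * L g z ∂μ = ∫ z, g z * L f z ∂μ
  nonpos : ∀ f : C^∞⟮𝓘(ℝ, E), M; ℝ⟯, HasCompactSupport f → ∫ z, f z * L f z ∂μ ≤ 0

namespace SymmetricDiffusion

variable {E : Type*} [NormedAddCommGroup E] [NormedSpace ℝ E]
  {M : Type*} [TopologicalSpace M] [ChartedSpace E M] [MeasurableSpace M] {μ : Measure M}

/-- The canonical distance `d(x,y) = sup {|f x - f y| : f ∈ C^∞(M), Γ(f,f) ≤ 1}`, as an element of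
`[0,∞]`. -/
noncomputable def dist (D : SymmetricDiffusion E μ) (x y : M) : ℝ≥0∞ :=
  ⨆ (f : C^∞⟮𝓘(ℝ, E), M; ℝ⟯) (_ : ∀ z, carreDuChamp D.L f f z ≤ 1), ENNReal.ofReal |f x - f y|

/-- `η(s,y) = -d(x,y)² / (2 (T - q s))`, for `s < T / q`. It is `⊥ = -∞` where `d(x,y) = ∞`. -/
noncomputable def eta (D : SymmetricDiffusion E μ) (x : M) (T q s : ℝ) (y : M) : EReal :=
  -((D.dist x y ^ 2 / ENNReal.ofReal (2 * (T - q * s)) : ℝ≥0∞) : EReal)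

/-- The space `C_c^∞(M)`. The (phantom) arguments `D` and `h` select the inner product
`⟨f, g⟩ = ∫ f g dμ - h ∫ f L g dμ` that it carries. -/
def TestFunction (_D : SymmetricDiffusion E μ) (_h : ℝ≥0) : Type _ :=
  {f : C^∞⟮𝓘(ℝ, E), M; ℝ⟯ // HasCompactSupport f}

namespace TestFunction

variable {D : SymmetricDiffusion E μ} {h : ℝ≥0}

/-- `C_c^∞(M)` as a linear subspace of `C^∞(M)`. -/
def submodule (E : Type*) [NormedAddCommGroup E] [NormedSpace ℝ E]
    (M : Type*) [TopologicalSpace M] [ChartedSpace E M] :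
    Submodule ℝ C^∞⟮𝓘(ℝ, E), M; ℝ⟯ where
  carrier := {f | HasCompactSupport f}
  zero_mem' := HasCompactSupport.zero
  add_mem' := fun hf hg => HasCompactSupport.add hf hg
  smul_mem' := fun c _ hf => HasCompactSupport.smul_left (f := fun _ => c) hf

noncomputable instance : AddCommGroup (TestFunction D h) := inferInstanceAs (AddCommGroup (submodule E M))

noncomputable instance : Module ℝ (TestFunction D h) := inferInstanceAs (Module ℝ (submodule E M))

theorem continuous (f : TestFunction D h) : Continuous f.1 := f.1.contMDiff.continuous

variable [OpensMeasurableSpace M] [IsFiniteMeasureOnCompacts μ]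

theorem integrable_mul (f : TestFunction D h) (g : C^∞⟮𝓘(ℝ, E), M; ℝ⟯) :
    Integrable (fun z => f.1 z * g z) μ :=
  (f.continuous.mul g.contMDiff.continuous).integrable_of_hasCompactSupport
    (HasCompactSupport.mul_right f.2)

/-- The inner product `⟨f, g⟩ = ∫ f g dμ - h ∫ f L g dμ` on `C_c^∞(M)`. -/
noncomputable instance instCore : PreInnerProductSpace.Core ℝ (TestFunction D h) where
  inner f g := ∫ z, f.1 z * g.1 z ∂μ - h * ∫ z, f.1 z * D.L g.1 z ∂μ
  conj_inner_symm f g := by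
    simp only [conj_trivial]
    rw [D.symm g.1 f.1 g.2 f.2]
    simp only [mul_comm]
  re_inner_nonneg f := by
    have h1 : 0 ≤ ∫ z, f.1 z * f.1 z ∂μ := integral_nonneg fun z => mul_self_nonneg _
    have h2 := mul_nonneg h.2 (neg_nonneg.2 (D.nonpos f.1 f.2))
    simp only [RCLike.re_to_real]
    have h3 : (h : ℝ) * -∫ z, f.1 z * D.L f.1 z ∂μ = -(h * ∫ z, f.1 z * D.L f.1 z ∂μ) := by ring
    have h4 : (0 : ℝ) ≤ h * -∫ z, f.1 z * D.L f.1 z ∂μ := h2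
    linarith
  add_left f g k := by
    have e1 : ∫ z, (f + g).1 z * k.1 z ∂μ = ∫ z, f.1 z * k.1 z ∂μ + ∫ z, g.1 z * k.1 z ∂μ := by
      rw [← integral_add (f.integrable_mul k.1) (g.integrable_mul k.1)]
      exact integral_congr_ae (ae_of_all _ fun z => add_mul (f.1 z) (g.1 z) _)
    have e2 : ∫ z, (f + g).1 z * D.L k.1 z ∂μ =
        ∫ z, f.1 z * D.L k.1 z ∂μ + ∫ z, g.1 z * D.L k.1 z ∂μ := by
      rw [← integral_add (f.integrable_mul (D.L k.1)) (g.integrable_mul (D.L k.1))]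
      exact integral_congr_ae (ae_of_all _ fun z => add_mul (f.1 z) (g.1 z) _)
    rw [e1, e2]
    ring
  smul_left f g r := by
    have e1 : ∫ z, (r • f).1 z * g.1 z ∂μ = r * ∫ z, f.1 z * g.1 z ∂μ := by
      rw [← integral_const_mul]
      exact integral_congr_ae (ae_of_all _ fun z => mul_assoc r (f.1 z) _)
    have e2 : ∫ z, (r • f).1 z * D.L g.1 z ∂μ = r * ∫ z, f.1 z * D.L g.1 z ∂μ := by
      rw [← integral_const_mul]
      exact integral_congr_ae (ae_of_all _ fun z => mul_assoc r (f.1 z) _)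
    rw [e1, e2]
    simp only [conj_trivial]
    ring

noncomputable instance : SeminormedAddCommGroup (TestFunction D h) :=
  InnerProductSpace.Core.toSeminormedAddCommGroup (𝕜 := ℝ) (c := instCore)

noncomputable instance : InnerProductSpace ℝ (TestFunction D h) :=
  InnerProductSpace.ofCore instCore

theorem inner_def (f g : TestFunction D h) :
    inner ℝ f g = ∫ z, f.1 z * g.1 z ∂μ - h * ∫ z, f.1 z * D.L g.1 z ∂μ := rfl

theorem memLp_two (f : TestFunction D h) : MemLp f.1 2 μ :=
  f.continuous.memLp_of_hasCompactSupport f.2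

theorem norm_toLp_le (f : TestFunction D h) : ‖f.memLp_two.toLp f.1‖ ≤ ‖f‖ := by
  refine (sq_le_sq₀ (norm_nonneg _) (norm_nonneg _)).1 ?_
  rw [← real_inner_self_eq_norm_sq, ← real_inner_self_eq_norm_sq, inner_def, L2.inner_def]
  have e : ∫ z, inner ℝ (f.memLp_two.toLp f.1 z) (f.memLp_two.toLp f.1 z) ∂μ =
      ∫ z, f.1 z * f.1 z ∂μ := by
    refine integral_congr_ae ?_
    filter_upwards [f.memLp_two.coeFn_toLp] with z hz
    rw [hz]
    rfl
  rw [e]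
  have h4 : (0 : ℝ) ≤ h * -∫ z, f.1 z * D.L f.1 z ∂μ :=
    mul_nonneg h.2 (neg_nonneg.2 (D.nonpos f.1 f.2))
  linarith

/-- The inclusion of `C_c^∞(M)` into `L²(M, μ)`. -/
noncomputable def toL2 (D : SymmetricDiffusion E μ) (h : ℝ≥0) :
    TestFunction D h →L[ℝ] Lp ℝ 2 μ :=
  LinearMap.mkContinuous
    { toFun := fun f => f.memLp_two.toLp f.1
      map_add' := fun f g => MemLp.toLp_add f.memLp_two g.memLp_two
      map_smul' := fun c f => MemLp.toLp_const_smul c f.memLp_two }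
    1 (fun f => (one_mul ‖f‖).symm ▸ f.norm_toLp_le)

end TestFunction

variable [OpensMeasurableSpace M] [IsFiniteMeasureOnCompacts μ]

/-- The Hilbert space obtained by completing `C_c^∞(M)` for `∫ f g dμ - h ∫ f L g dμ`. For `h > 0`
this is the domain of the closure of the Dirichlet form `-∫ f L g dμ`. -/
abbrev FormDomain (D : SymmetricDiffusion E μ) (h : ℝ≥0) : Type _ :=
  UniformSpace.Completion (TestFunction D h)

/-- The continuous extension to `FormDomain D h` of the inclusion of `C_c^∞(M)` into `L²(M, μ)`. -/
noncomputable def formDomainToL2 (D : SymmetricDiffusion E μ) (h : ℝ≥0) :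
    FormDomain D h →L[ℝ] Lp ℝ 2 μ :=
  (TestFunction.toL2 D h).extend UniformSpace.Completion.toComplL

/-- The resolvent `(1 - h L)⁻¹` on `L²(M, μ)`, where `L` stands for the self-adjoint (Friedrichs)
extension of `L` on `C_c^∞(M)`, the generator of the closure of the form `-∫ f L g dμ`.
It is the composition of the inclusion of the form domain with its adjoint: `u = (1 - h L)⁻¹ f` is
the element of the form domain with `⟨u, φ⟩ = ∫ f φ dμ` for all `φ` in the form domain. -/
noncomputable def resolvent (D : SymmetricDiffusion E μ) (h : ℝ≥0) : Lp ℝ 2 μ →L[ℝ] Lp ℝ 2 μ :=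
  formDomainToL2 D h ∘L (formDomainToL2 D h).adjoint

/-- The semigroup `P_t = e^{tL}` on `L²(M, μ)`, by the exponential formula
`P_t f = lim_n (1 - (t/n) L)⁻ⁿ f`, along `n = 2 ^ k`. -/
noncomputable def semigroupL2 (D : SymmetricDiffusion E μ) (t : ℝ≥0) (f : Lp ℝ 2 μ) : Lp ℝ 2 μ :=
  limUnder atTop fun k : ℕ => ((D.resolvent (t / 2 ^ k)) ^ (2 ^ k)) f

theorem dense_toComplL (D : SymmetricDiffusion E μ) (h : ℝ≥0) :
    DenseRange (UniformSpace.Completion.toComplL : TestFunction D h →L[ℝ] FormDomain D h) :=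
  UniformSpace.Completion.denseRange_coe

theorem formDomainToL2_coe (D : SymmetricDiffusion E μ) (h : ℝ≥0) (φ : TestFunction D h) :
    formDomainToL2 D h (φ : FormDomain D h) = TestFunction.toL2 D h φ :=
  ContinuousLinearMap.extend_eq _ (dense_toComplL D h)
    (UniformSpace.Completion.isUniformInducing_coe _) φ

theorem inner_toL2 (D : SymmetricDiffusion E μ) (h h' : ℝ≥0) (φ ψ : TestFunction D h) :
    inner ℝ (TestFunction.toL2 D h φ) (TestFunction.toL2 D h' ψ) = ∫ z, φ.1 z * ψ.1 z ∂μ := by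
  rw [L2.inner_def]
  refine integral_congr_ae ?_
  filter_upwards [φ.memLp_two.coeFn_toLp, ψ.memLp_two.coeFn_toLp] with z h1 h2
  change inner ℝ (φ.memLp_two.toLp φ.1 z) (ψ.memLp_two.toLp ψ.1 z) = _
  rw [h1, h2]
  exact mul_comm _ _

/-- The identity on test functions, as a contraction from the norm of parameter `h` to that of
parameter `h / 2`. -/
noncomputable def half (D : SymmetricDiffusion E μ) (h : ℝ≥0) :
    TestFunction D h →L[ℝ] TestFunction D (h / 2) :=
  LinearMap.mkContinuous { toFun := fun f => (f : TestFunction D (h / 2))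
                           map_add' := fun _ _ => rfl
                           map_smul' := fun _ _ => rfl } 1 (fun f => by
    rw [one_mul]
    refine (sq_le_sq₀ (norm_nonneg _) (norm_nonneg _)).1 ?_
    rw [← real_inner_self_eq_norm_sq, ← real_inner_self_eq_norm_sq, TestFunction.inner_def,
      TestFunction.inner_def]
    have h4 : (0 : ℝ) ≤ h * -∫ z, f.1 z * D.L f.1 z ∂μ :=
      mul_nonneg h.2 (neg_nonneg.2 (D.nonpos f.1 f.2))
    push_cast
    change ∫ z, f.1 z * f.1 z ∂μ - (h:ℝ) / 2 * ∫ z, f.1 z * D.L f.1 z ∂μ ≤ _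
    linarith)

/-- The continuous extension of `half` to the completions. -/
noncomputable def halfCompl (D : SymmetricDiffusion E μ) (h : ℝ≥0) :
    FormDomain D h →L[ℝ] FormDomain D (h / 2) :=
  (UniformSpace.Completion.toComplL ∘L half D h).extend UniformSpace.Completion.toComplL

theorem halfCompl_coe (D : SymmetricDiffusion E μ) (h : ℝ≥0) (φ : TestFunction D h) :
    halfCompl D h (φ : FormDomain D h) = (half D h φ : FormDomain D (h / 2)) :=
  ContinuousLinearMap.extend_eq _ (dense_toComplL D h)
    (UniformSpace.Completion.isUniformInducing_coe _) φ

theorem formDomainToL2_halfCompl (D : SymmetricDiffusion E μ) (h : ℝ≥0) (v : FormDomain D h) :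
    formDomainToL2 D (h / 2) (halfCompl D h v) = formDomainToL2 D h v := by
  induction v using UniformSpace.Completion.induction_on with
  | hp => exact isClosed_eq (by fun_prop) (by fun_prop)
  | ih ψ => rw [halfCompl_coe, formDomainToL2_coe, formDomainToL2_coe]; rfl

theorem inner_halfCompl (D : SymmetricDiffusion E μ) (h : ℝ≥0) (v w : FormDomain D h) :
    2 * inner ℝ (halfCompl D h v) (halfCompl D h w) =
      inner ℝ (formDomainToL2 D h v) (formDomainToL2 D h w) + inner ℝ v w := by
  induction v, w using UniformSpace.Completion.induction_on₂ with
  | hp => exact isClosed_eq (by fun_prop) (by fun_prop)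
  | ih ψ φ =>
    rw [halfCompl_coe, halfCompl_coe, formDomainToL2_coe, formDomainToL2_coe,
      UniformSpace.Completion.inner_coe, UniformSpace.Completion.inner_coe, inner_toL2,
      TestFunction.inner_def, TestFunction.inner_def]
    change 2 * (∫ z, ψ.1 z * φ.1 z ∂μ - ((h / 2 : ℝ≥0) : ℝ) * ∫ z, ψ.1 z * D.L φ.1 z ∂μ) = _
    push_cast
    ring

theorem halfCompl_dense (D : SymmetricDiffusion E μ) (h : ℝ≥0) : DenseRange (halfCompl D h) := by
  refine (dense_toComplL D (h / 2)).mono ?_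
  rintro _ ⟨φ, rfl⟩
  exact ⟨UniformSpace.Completion.coe' (α := TestFunction D h) φ, halfCompl_coe D h φ⟩

theorem resolvent_half (D : SymmetricDiffusion E μ) (h : ℝ≥0) :
    (2 : ℝ) • D.resolvent h = D.resolvent (h / 2) * (1 + D.resolvent h) := by
  ext1 f
  set v := (formDomainToL2 D h).adjoint f with hv
  have key : (formDomainToL2 D (h / 2)).adjoint (f + formDomainToL2 D h v) =
      (2 : ℝ) • halfCompl D h v := by
    refine (halfCompl_dense D h).eq_of_inner_left (𝕜 := ℝ) ?_
    intro w
    rw [ContinuousLinearMap.adjoint_inner_left, formDomainToL2_halfCompl, inner_smul_left,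
      inner_add_left, ← ContinuousLinearMap.adjoint_inner_left, ← hv]
    have := inner_halfCompl D h v w
    simp only [conj_trivial]
    linarith
  change (2 : ℝ) • formDomainToL2 D h v =
    formDomainToL2 D (h / 2) ((formDomainToL2 D (h / 2)).adjoint (f + formDomainToL2 D h v))
  rw [key, map_smul, formDomainToL2_halfCompl]

theorem resolvent_adjoint (D : SymmetricDiffusion E μ) (h : ℝ≥0) :
    star (D.resolvent h) = D.resolvent h := by
  rw [ContinuousLinearMap.star_eq_adjoint, resolvent, ContinuousLinearMap.adjoint_comp,
    ContinuousLinearMap.adjoint_adjoint]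

theorem resolvent_inner_nonneg (D : SymmetricDiffusion E μ) (h : ℝ≥0) (f : Lp ℝ 2 μ) :
    0 ≤ inner ℝ (D.resolvent h f) f := by
  rw [resolvent, ContinuousLinearMap.comp_apply, ← ContinuousLinearMap.adjoint_inner_right]
  exact real_inner_self_nonneg

theorem resolvent_commute_half (D : SymmetricDiffusion E μ) (h : ℝ≥0) :
    D.resolvent h * D.resolvent (h / 2) = D.resolvent (h / 2) * D.resolvent h := by
  have h1 := resolvent_half D h
  have h2 := congrArg star h1
  rw [star_smul, star_mul, star_add, star_one, resolvent_adjoint, resolvent_adjoint,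
    show star (2 : ℝ) = 2 from rfl, h1] at h2
  simp only [mul_add, add_mul, mul_one, one_mul] at h2
  exact (add_left_cancel h2).symm

theorem resolvent_sub_sq (D : SymmetricDiffusion E μ) (h : ℝ≥0) :
    D.resolvent h - D.resolvent (h / 2) ^ 2 =
      (1 - D.resolvent (h / 2)) * D.resolvent h * (1 - D.resolvent (h / 2)) := by
  have h1 := resolvent_half D h
  have h2 := resolvent_commute_half D h
  rw [mul_add, mul_one, two_smul] at h1
  generalize D.resolvent h = A at *
  generalize D.resolvent (h / 2) = B at *
  have h3 : B * A = A + A - B := by rw [h1]; abel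
  have h4 : A * B = A + A - B := by rw [h2, h3]
  have : (1 - B) * A * (1 - B) = A - B * A - A * B + (B * A) * B := by noncomm_ring
  rw [this, h3, h4, sub_mul, add_mul, h4]
  noncomm_ring

theorem pow_inner_nonneg {H : Type*} [NormedAddCommGroup H] [InnerProductSpace ℝ H]
    [CompleteSpace H] {A : H →L[ℝ] H} (hA : star A = A) (hA0 : ∀ f, 0 ≤ inner ℝ (A f) f) :
    ∀ (n : ℕ) (f : H), 0 ≤ inner ℝ ((A ^ n) f) f
  | 0, f => by simp
  | 1, f => by simpa using hA0 f
  | n + 2, f => by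
    have e : A ^ (n + 2) = A * A ^ n * A := by rw [pow_succ, pow_succ']
    rw [e]
    change 0 ≤ inner ℝ (A ((A ^ n) (A f))) f
    rw [← ContinuousLinearMap.adjoint_inner_right, ← ContinuousLinearMap.star_eq_adjoint, hA]
    exact pow_inner_nonneg hA hA0 n (A f)

theorem pow_sub_inner_nonneg {H : Type*} [NormedAddCommGroup H] [InnerProductSpace ℝ H]
    [CompleteSpace H] {A B : H →L[ℝ] H} (hA : star A = A) (hA0 : ∀ f, 0 ≤ inner ℝ (A f) f)
    (hB : star B = B) (hAB : A * B = B * A) (h : A - B ^ 2 = (1 - B) * A * (1 - B)) :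
    ∀ (n : ℕ) (f : H), 0 ≤ inner ℝ ((A ^ n - (B ^ 2) ^ n) f) f
  | 0, f => by simp
  | n + 1, f => by
    have c : Commute A B := hAB
    have c1 : Commute (A ^ n) (1 - B) := (Commute.one_right _).sub_right (c.pow_left n)
    have c2 : Commute (A ^ n - (B ^ 2) ^ n) B :=
      (c.pow_left n).sub_left (((Commute.refl B).pow_left 2).pow_left n)
    have e : A ^ (n + 1) - (B ^ 2) ^ (n + 1) =
        (1 - B) * A ^ (n + 1) * (1 - B) + B * (A ^ n - (B ^ 2) ^ n) * B := by
      rw [← c2.eq, pow_succ A, ← mul_assoc (1 - B), ← c1.eq, mul_assoc (A ^ n), mul_assoc (A ^ n),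
        ← h, pow_succ (B ^ 2)]
      noncomm_ring
    have hB1 : star (1 - B) = 1 - B := by rw [star_sub, star_one, hB]
    have t1 := pow_inner_nonneg hA hA0 (n + 1) ((1 - B) f)
    have t2 := pow_sub_inner_nonneg hA hA0 hB hAB h n (B f)
    rw [e, add_apply, inner_add_left]
    refine add_nonneg ?_ ?_
    · change 0 ≤ inner ℝ ((1 - B) ((A ^ (n + 1)) ((1 - B) f))) f
      rwa [← ContinuousLinearMap.adjoint_inner_right, ← ContinuousLinearMap.star_eq_adjoint, hB1]
    · change 0 ≤ inner ℝ (B ((A ^ n - (B ^ 2) ^ n) (B f))) f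
      rwa [← ContinuousLinearMap.adjoint_inner_right, ← ContinuousLinearMap.star_eq_adjoint, hB]

/-- A decreasing sequence of positive self-adjoint operators converges strongly. -/
theorem exists_tendsto_of_antitone {H : Type*} [NormedAddCommGroup H] [InnerProductSpace ℝ H]
    [CompleteSpace H] {S : ℕ → H →L[ℝ] H} (hS : ∀ k, star (S k) = S k)
    (h0 : ∀ k f, 0 ≤ inner ℝ (S k f) f)
    (h1 : ∀ k f, inner ℝ (S (k + 1) f) f ≤ inner ℝ (S k f) f) (f : H) :
    ∃ g, Tendsto (fun k => S k f) atTop (𝓝 g) := by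
  have hanti : ∀ f, Antitone fun k => inner ℝ (S k f) f := fun f => antitone_nat_of_succ_le (h1 · f)
  set C : ℝ := ‖S 0‖ + 1 with hC
  have hC0 : 0 < C := by positivity
  have key : ∀ k m, k ≤ m → ‖S k f - S m f‖ ^ 2 ≤
      C * (inner ℝ (S k f) f - inner ℝ (S m f) f) := by
    intro k m hkm
    set X := S k - S m with hX
    have hXs : ∀ a b, inner ℝ (X a) b = inner ℝ a (X b) := by
      intro a b
      rw [← ContinuousLinearMap.adjoint_inner_right, ← ContinuousLinearMap.star_eq_adjoint, hX,
        star_sub, hS, hS]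
    have hX0 : ∀ a, 0 ≤ inner ℝ (X a) a := by
      intro a
      have := hanti a hkm
      simp only [hX, sub_apply, inner_sub_left]
      linarith
    have hXC : ∀ a, inner ℝ (X a) a ≤ C * ‖a‖ ^ 2 := by
      intro a
      have e1 := hanti a (Nat.zero_le k)
      have e2 := h0 m a
      have e3 : inner ℝ (S 0 a) a ≤ ‖S 0‖ * ‖a‖ ^ 2 := by
        refine (real_inner_le_norm _ _).trans ?_
        rw [sq, ← mul_assoc]
        exact mul_le_mul_of_nonneg_right ((S 0).le_opNorm a) (norm_nonneg _)
      simp only [hX, sub_apply, inner_sub_left]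
      simp only at e1
      nlinarith [sq_nonneg ‖a‖]
    have hXf : S k f - S m f = X f := rfl
    rw [hXf, ← inner_sub_left, hXf]
    have q := hX0 (f - C⁻¹ • X f)
    have r := hXC (X f)
    rw [map_sub, map_smul, inner_sub_left, inner_sub_right, inner_sub_right, inner_smul_left,
      inner_smul_right, inner_smul_left, inner_smul_right, hXs (X f) f,
      real_inner_self_eq_norm_sq] at q
    simp only [conj_trivial] at q
    have q2 : C⁻¹ * (C⁻¹ * inner ℝ (X (X f)) (X f)) ≤ C⁻¹ * ‖X f‖ ^ 2 := by
      refine mul_le_mul_of_nonneg_left ?_ (by positivity)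
      rw [inv_mul_le_iff₀ hC0]
      exact r
    have q3 : C⁻¹ * ‖X f‖ ^ 2 ≤ inner ℝ (X f) f := by linarith
    rwa [inv_mul_le_iff₀ hC0] at q3
  have hlim : ∃ l, Tendsto (fun k => inner ℝ (S k f) f) atTop (𝓝 l) :=
    ⟨_, tendsto_atTop_ciInf (hanti f) ⟨0, by rintro _ ⟨k, rfl⟩; exact h0 k f⟩⟩
  obtain ⟨l, hl⟩ := hlim
  refine cauchySeq_tendsto_of_complete ?_
  rw [Metric.cauchySeq_iff']
  intro ε hε
  have hl2 := hl.cauchySeq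
  rw [Metric.cauchySeq_iff'] at hl2
  obtain ⟨N, hN⟩ := hl2 (ε ^ 2 / C) (by positivity)
  refine ⟨N, fun n hn => ?_⟩
  have a1 := hN n hn
  rw [Real.dist_eq, abs_sub_comm] at a1
  have a2 := key N n hn
  have a3 := (le_abs_self _).trans_lt a1
  rw [lt_div_iff₀ hC0] at a3
  rw [dist_comm, dist_eq_norm]
  exact lt_of_pow_lt_pow_left₀ 2 hε.le (by linarith)

/-- The limit that defines the semigroup on `L²` exists. -/
theorem tendsto_semigroupL2 (D : SymmetricDiffusion E μ) (t : ℝ≥0) (f : Lp ℝ 2 μ) :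
    Tendsto (fun k : ℕ => ((D.resolvent (t / 2 ^ k)) ^ (2 ^ k)) f) atTop
      (𝓝 (D.semigroupL2 t f)) := by
  refine tendsto_nhds_limUnder (exists_tendsto_of_antitone
    (S := fun k : ℕ => (D.resolvent (t / 2 ^ k)) ^ (2 ^ k)) ?_ ?_ ?_ f)
  · intro k
    rw [star_pow, resolvent_adjoint]
  · exact fun k => pow_inner_nonneg (resolvent_adjoint D _) (resolvent_inner_nonneg D _) _
  · intro k g
    have e : t / 2 ^ (k + 1) = t / 2 ^ k / 2 := by rw [pow_succ, div_div]
    have := pow_sub_inner_nonneg (resolvent_adjoint D (t / 2 ^ k)) (resolvent_inner_nonneg D _)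
      (resolvent_adjoint D (t / 2 ^ k / 2)) (resolvent_commute_half D _) (resolvent_sub_sq D _)
      (2 ^ k) g
    rw [sub_apply, inner_sub_left, ← pow_mul, ← pow_succ', ← e] at this
    linarith

/-- A bounded function cut off to a compact set belongs to `L²`. -/
theorem memLp_two_indicator [T2Space M] {f : M → ℝ} (hf : MemLp f ∞ μ) {K : Set M}
    (hK : IsCompact K) : MemLp (K.indicator f) 2 μ := by
  have : IsFiniteMeasure (μ.restrict K) := ⟨by simpa using hK.measure_lt_top⟩
  exact (memLp_indicator_iff_restrict hK.measurableSet).2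
    ((hf.restrict K).mono_exponent le_top)

/-- The semigroup on nonnegative `f ∈ L^∞(M)`: `P_t f` is the monotone limit of `P_t (f 1_{K_n})`
along an exhaustion `K_0 ⊆ K_1 ⊆ ...` of `M` by compact sets. -/
noncomputable def semigroup [T2Space M] [SigmaCompactSpace M] (D : SymmetricDiffusion E μ)
    (t : ℝ≥0) (f : M → ℝ) (hf : MemLp f ∞ μ) (y : M) : ℝ≥0∞ :=
  ⨆ n : ℕ, ENNReal.ofReal
    (D.semigroupL2 t ((memLp_two_indicator hf (isCompact_compactCovering M n)).toLp _) y)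

end SymmetricDiffusion

/-!
The inequality is the integrated maximum principle for the heat semigroup, proved along the implicit
Euler scheme that defines `semigroupL2`. Formally, if `∂ₛη + (q / 2) Γ(η) ≤ 0`, then
`d/ds ∫ u ^ p e^η = -p (p - 1) ∫ u ^ (p - 2) Γ(u) e^η - p ∫ u ^ (p - 1) Γ(u, η) e^η + ∫ u ^ p ∂ₛη e^η`
is at most zero: completing the square in the first two terms leaves
`(p / (4 (p - 1))) ∫ u ^ p Γ(η) e^η`, and `q / 2 = p / (4 (p - 1))`. The function
`η = -g² / (2 (T - q s))` satisfies the hypothesis as soon as `Γ(g) ≤ 1`.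

Here the time derivative is replaced by one resolvent step `u = (1 - h L)⁻¹ f`, for which there is an
inequality with a factor `1 - O(h²)` (`resolvent_weighted_le`). The main point is
`integral_resolvent_le`, the equation `u - h L u = f` tested against `G(u) e^η` with `G` analytic and
bi-Lipschitz. It needs no chain rule in the closure of the form domain: the test functions
`G(φ) e^η`, with `φ ∈ C_c^∞` converging to `u`, are bounded in the form norm, the square is completed
at the level of `φ`, where the chain rule for `Γ` follows from the derivation property and Hadamard's
lemma, and Fatou's lemma gives the limit. With `G` close to a positive part it yields the
sub-Markov property of the resolvent (`resolvent_le_of_le`), which is also the source of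
positivity, of `L¹` bounds by duality and of the monotonicity of `P_t`. With `G = regPow`, a
regularization of `x ^ (p - 1)`, it yields the step inequality, by Young's inequality. The `N` steps of
size `t / N` multiply the errors to `(1 - O(t² / N²)) ^ N → 1` (`semigroupL2_weighted_le`).

The distance is not smooth, but it is a pointwise limit of bounded smooth functions with `Γ ≤ 1`
(`exists_seq_tendsto_dist`): admissible functions can be truncated, countably many of them suffice by
the Lindelöf property, and finitely many have a smooth maximum, the log-sum-exp. Fatou's lemma on the
left, dominated convergence on the right and monotone convergence in the cut-off of the initial datum
conclude.
-/

set_option linter.unusedSectionVars false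

/-! ### Calculus of the carré du champ -/

/-- Hadamard's lemma for real-analytic functions of one variable. -/
theorem AnalyticOnNhd.contDiff_dslope {G : ℝ → ℝ} (hG : AnalyticOnNhd ℝ G Set.univ) (a : ℝ) :
    ContDiff ℝ ∞ (dslope G a) := by
  rw [contDiff_iff_contDiffAt]
  intro x
  by_cases hx : x = a
  · subst hx
    obtain ⟨p, hp⟩ := hG x trivial
    exact (HasFPowerSeriesAt.has_fpower_series_dslope_fslope hp).analyticAt.contDiffAt
  · have hq : ContDiffAt ℝ ∞ (fun y => (y - a)⁻¹ * (G y - G a)) x :=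
      ((contDiffAt_id.sub contDiffAt_const).inv (sub_ne_zero.2 hx)).mul
        ((hG x trivial).contDiffAt.sub contDiffAt_const)
    refine hq.congr_of_eventuallyEq ?_
    filter_upwards [isOpen_ne.mem_nhds hx] with y hy
    rw [dslope_of_ne _ hy, slope_def_module, smul_eq_mul]

namespace SymmetricDiffusion

section Calculus

variable {E : Type*} [NormedAddCommGroup E] [NormedSpace ℝ E]
  {M : Type*} [TopologicalSpace M] [ChartedSpace E M] [MeasurableSpace M] {μ : Measure M}

/-- The carré du champ of the operator of `D`. -/
noncomputable abbrev Γ (D : SymmetricDiffusion E μ) (f g : C^∞⟮𝓘(ℝ, E), M; ℝ⟯) :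
    C^∞⟮𝓘(ℝ, E), M; ℝ⟯ := carreDuChamp D.L f g

/-- The smooth function `G ∘ f`. -/
noncomputable def postcomp (G : ℝ → ℝ) (hG : ContDiff ℝ ∞ G) (f : C^∞⟮𝓘(ℝ, E), M; ℝ⟯) :
    C^∞⟮𝓘(ℝ, E), M; ℝ⟯ :=
  ⟨fun z => G (f z), hG.contMDiff.comp f.contMDiff⟩

@[simp]
theorem postcomp_apply (G : ℝ → ℝ) (hG : ContDiff ℝ ∞ G) (f : C^∞⟮𝓘(ℝ, E), M; ℝ⟯) (z : M) :
    postcomp G hG f z = G (f z) := rfl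

variable (D : SymmetricDiffusion E μ) (f g k : C^∞⟮𝓘(ℝ, E), M; ℝ⟯) (z : M)

theorem Γ_apply : D.Γ f g z = (1 / 2) * (D.L (f * g) z - f z * D.L g z - g z * D.L f z) := rfl

theorem Γ_comm : D.Γ f g = D.Γ g f := by
  simp only [carreDuChamp, mul_comm f g]
  congr 1
  ring

theorem Γ_add_left : D.Γ (f + g) k = D.Γ f k + D.Γ g k := by
  ext z
  change D.Γ (f + g) k z = D.Γ f k z + D.Γ g k z
  simp only [Γ_apply, add_mul, map_add]
  change (1 / 2) * ((D.L (f * k) z + D.L (g * k) z) - (f z + g z) * D.L k z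
    - k z * (D.L f z + D.L g z)) = _
  ring

theorem Γ_smul_left (c : ℝ) : D.Γ (c • f) k = c • D.Γ f k := by
  ext z
  change D.Γ (c • f) k z = c * D.Γ f k z
  simp only [Γ_apply, smul_mul_assoc, map_smul]
  change (1 / 2) * (c * D.L (f * k) z - (c * f z) * D.L k z - k z * (c * D.L f z)) = _
  ring

theorem Γ_zero_left : D.Γ 0 k = 0 := by
  have := D.Γ_smul_left 0 k 0
  rwa [zero_smul, zero_smul] at this

theorem Γ_add_right : D.Γ k (f + g) = D.Γ k f + D.Γ k g := by
  rw [D.Γ_comm, Γ_add_left, D.Γ_comm f, D.Γ_comm g]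

theorem Γ_smul_right (c : ℝ) : D.Γ k (c • f) = c • D.Γ k f := by
  rw [D.Γ_comm, Γ_smul_left, D.Γ_comm f]

theorem Γ_one_left : D.Γ 1 k = 0 := by
  ext z
  change D.Γ 1 k z = 0
  rw [Γ_apply, one_mul, D.map_one]
  change (1 / 2) * (D.L k z - 1 * D.L k z - k z * 0) = 0
  ring

theorem Γ_mul_left : D.Γ (f * g) k z = f z * D.Γ g k z + g z * D.Γ f k z := by
  rw [Γ, D.leibniz]; rfl

theorem Γ_mul_right : D.Γ k (f * g) z = f z * D.Γ k g z + g z * D.Γ k f z := by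
  rw [D.Γ_comm, Γ_mul_left, D.Γ_comm f, D.Γ_comm g]

theorem Γ_self_nonneg : 0 ≤ D.Γ f f z := D.carreDuChamp_nonneg f z

/-- The chain rule, a consequence of the derivation property alone: by Hadamard's lemma
`G ∘ f = G (f z) + (f - f z) H` with `H` smooth and `H z = G' (f z)`. -/
theorem Γ_postcomp_left {G : ℝ → ℝ} (hG : AnalyticOnNhd ℝ G Set.univ) (hG' : ContDiff ℝ ∞ G) :
    D.Γ (postcomp G hG' f) k z = deriv G (f z) * D.Γ f k z := by
  set H := postcomp (dslope G (f z)) (hG.contDiff_dslope (f z)) f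
  have e : postcomp G hG' f = G (f z) • 1 + (f + (-f z) • 1) * H := by
    ext y
    change G (f y) = G (f z) * 1 + (f y + (-f z) * 1) * dslope G (f z) (f y)
    have := sub_smul_dslope G (f z) (f y)
    rw [smul_eq_mul] at this
    linear_combination -this
  rw [e, Γ_add_left, Γ_smul_left, Γ_one_left, smul_zero, zero_add, Γ_mul_left, Γ_add_left,
    Γ_smul_left, Γ_one_left, smul_zero, add_zero]
  change (f z + (-f z) * 1) * _ + dslope G (f z) (f z) * _ = _
  rw [dslope_same]
  ring

theorem Γ_postcomp_self {G : ℝ → ℝ} (hG : AnalyticOnNhd ℝ G Set.univ) (hG' : ContDiff ℝ ∞ G) :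
    D.Γ (postcomp G hG' f) (postcomp G hG' f) z = deriv G (f z) ^ 2 * D.Γ f f z := by
  rw [Γ_postcomp_left D _ _ _ hG, D.Γ_comm, Γ_postcomp_left D _ _ _ hG]
  ring

theorem Γ_quadratic (c : ℝ) :
    D.Γ (f + c • g) (f + c • g) z = D.Γ f f z + 2 * c * D.Γ f g z + c ^ 2 * D.Γ g g z := by
  rw [Γ_add_left, Γ_add_right, Γ_add_right, Γ_smul_left, Γ_smul_left, Γ_smul_right, Γ_smul_right,
    D.Γ_comm g f]
  change D.Γ f f z + c * D.Γ f g z + (c * D.Γ f g z + c * (c * D.Γ g g z)) = _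
  ring

/-- The Cauchy-Schwarz inequality for `Γ`. -/
theorem Γ_sq_le : D.Γ f g z ^ 2 ≤ D.Γ f f z * D.Γ g g z := by
  have h : ∀ c : ℝ, 0 ≤ D.Γ g g z * (c * c) + (2 * D.Γ f g z) * c + D.Γ f f z := by
    intro c
    have := D.Γ_self_nonneg (f + c • g) z
    rw [Γ_quadratic] at this
    linarith
  have := discrim_le_zero h
  rw [discrim] at this
  linarith

theorem Γ_add_self_le {a b : ℝ} (ha : 0 ≤ a) (hb : 0 ≤ b) (hf : D.Γ f f z ≤ a ^ 2)
    (hg : D.Γ g g z ≤ b ^ 2) : D.Γ (f + g) (f + g) z ≤ (a + b) ^ 2 := by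
  have h1 := D.Γ_quadratic f g z 1
  rw [one_smul] at h1
  have h2 : D.Γ f g z ≤ a * b := by
    refine le_of_sq_le_sq ?_ (by positivity) |>.trans le_rfl
    calc D.Γ f g z ^ 2 ≤ D.Γ f f z * D.Γ g g z := D.Γ_sq_le f g z
      _ ≤ a ^ 2 * b ^ 2 := mul_le_mul hf hg (D.Γ_self_nonneg g z) (sq_nonneg a)
      _ = (a * b) ^ 2 := by ring
  rw [h1]
  nlinarith

/-- `Γ (f g) ≤ 2 f² Γ(g) + 2 g² Γ(f)`. -/
theorem Γ_mul_self_le :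
    D.Γ (f * g) (f * g) z ≤ 2 * (f z ^ 2 * D.Γ g g z + g z ^ 2 * D.Γ f f z) := by
  have e : D.Γ (f * g) (f * g) z =
      f z ^ 2 * D.Γ g g z + 2 * (f z * g z) * D.Γ f g z + g z ^ 2 * D.Γ f f z := by
    rw [Γ_mul_left, Γ_mul_right, Γ_mul_right, D.Γ_comm g f]
    ring
  have h := D.Γ_quadratic ((g z) • f) g z (-(f z))
  have h0 := D.Γ_self_nonneg ((g z) • f + (-(f z)) • g) z
  rw [h, Γ_smul_left, Γ_smul_left, Γ_smul_right] at h0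
  change 0 ≤ g z * (g z * D.Γ f f z) + 2 * -f z * (g z * D.Γ f g z) + _ at h0
  rw [e]
  nlinarith

variable [FiniteDimensional ℝ E] [IsManifold 𝓘(ℝ, E) ∞ M] [T2Space M]

theorem exists_mul_eq_of_eventually_zero (hf : f =ᶠ[𝓝 z] 0) :
    ∃ b : C^∞⟮𝓘(ℝ, E), M; ℝ⟯, b z = 0 ∧ f = b * f := by
  obtain ⟨b, -, hb⟩ := (SmoothBumpFunction.nhds_basis_support (I := 𝓘(ℝ, E)) (c := z) hf).mem_iff.1 hf
  refine ⟨1 - ⟨b, b.contMDiff⟩, ?_, ?_⟩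
  · change 1 - b z = 0
    rw [b.eq_one, sub_self]
  · ext y
    change f y = (1 - b y) * f y
    by_cases hy : b y = 0
    · rw [hy]; ring
    · have : f y = 0 := hb hy
      rw [this]; ring

/-- `Γ` is local. -/
theorem Γ_eq_zero_of_eventually_zero (hf : f =ᶠ[𝓝 z] 0) : D.Γ f k z = 0 := by
  obtain ⟨b, hb, e⟩ := exists_mul_eq_of_eventually_zero f z hf
  have hz : f z = 0 := hf.self_of_nhds
  rw [e, Γ_mul_left, hb, hz]
  ring

/-- `L` is local. -/
theorem L_eq_zero_of_eventually_zero (hf : f =ᶠ[𝓝 z] 0) : D.L f z = 0 := by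
  obtain ⟨b, hb, e⟩ := exists_mul_eq_of_eventually_zero f z hf
  have hz : f z = 0 := hf.self_of_nhds
  have h1 := D.Γ_apply b f z
  rw [D.Γ_comm, D.Γ_eq_zero_of_eventually_zero f b z hf, ← e, hb, hz] at h1
  linarith

theorem tsupport_L_subset : tsupport (D.L f) ⊆ tsupport f := by
  refine closure_minimal ?_ (isClosed_tsupport f)
  intro z hz
  by_contra h
  exact hz (D.L_eq_zero_of_eventually_zero f z (notMem_tsupport_iff_eventuallyEq.1 h))

theorem L_eq_zero_of_eventually_one (hf : f =ᶠ[𝓝 z] 1) : D.L f z = 0 := by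
  have h := D.L_eq_zero_of_eventually_zero (f - 1) z (by
    filter_upwards [hf] with y hy
    change f y - 1 = 0
    rw [hy]; exact sub_self _)
  rwa [map_sub, D.map_one, sub_zero] at h

end Calculus

end SymmetricDiffusion

/-! ### Integration by parts and testing the resolvent equation -/

/-- Fatou's lemma along an almost everywhere convergent sequence of nonnegative functions, with
Bochner integrals on the right. -/
theorem lintegral_ofReal_le_of_tendsto_ae {α : Type*} [MeasurableSpace α] {μ : Measure α}
    {Z : ℕ → α → ℝ} {W : α → ℝ} {e : ℕ → ℝ} {l : ℝ} (hZ : ∀ n, Integrable (Z n) μ)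
    (hZ0 : ∀ n, 0 ≤ᵐ[μ] Z n)
    (hlim : ∀ᵐ z ∂μ, Tendsto (fun n => Z n z) atTop (𝓝 (W z)))
    (he : ∀ᶠ n in atTop, ∫ z, Z n z ∂μ ≤ e n) (hl : Tendsto e atTop (𝓝 l)) :
    ∫⁻ z, ENNReal.ofReal (W z) ∂μ ≤ ENNReal.ofReal l := by
  calc ∫⁻ z, ENNReal.ofReal (W z) ∂μ
      = ∫⁻ z, liminf (fun n => ENNReal.ofReal (Z n z)) atTop ∂μ := by
        refine lintegral_congr_ae ?_
        filter_upwards [hlim] with z hz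
        exact ((ENNReal.continuous_ofReal.tendsto _).comp hz).liminf_eq.symm
    _ ≤ liminf (fun n => ∫⁻ z, ENNReal.ofReal (Z n z) ∂μ) atTop :=
        lintegral_liminf_le' fun n => (hZ n).aestronglyMeasurable.aemeasurable.ennreal_ofReal
    _ ≤ liminf (fun n => ENNReal.ofReal (e n)) atTop := by
        refine liminf_le_liminf ?_
        filter_upwards [he] with n hn
        rw [← ofReal_integral_eq_lintegral_ofReal (hZ n) (hZ0 n)]
        exact ENNReal.ofReal_le_ofReal hn
    _ = ENNReal.ofReal l := ((ENNReal.continuous_ofReal.tendsto _).comp hl).liminf_eq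

theorem integral_le_of_tendsto_ae_of_nonneg {α : Type*} [MeasurableSpace α] {μ : Measure α}
    {Z : ℕ → α → ℝ} {W : α → ℝ} {e : ℕ → ℝ} {l : ℝ} (hZ : ∀ n, Integrable (Z n) μ)
    (hZ0 : ∀ n z, 0 ≤ Z n z) (hW : Integrable W μ)
    (hlim : ∀ᵐ z ∂μ, Tendsto (fun n => Z n z) atTop (𝓝 (W z)))
    (he : ∀ n, ∫ z, Z n z ∂μ ≤ e n) (hl : Tendsto e atTop (𝓝 l)) : ∫ z, W z ∂μ ≤ l := by
  have hW0 : 0 ≤ᵐ[μ] W := by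
    filter_upwards [hlim] with z hz using ge_of_tendsto' hz fun n => hZ0 n z
  have hl0 : 0 ≤ l := ge_of_tendsto' hl fun n => (integral_nonneg (hZ0 n)).trans (he n)
  rw [← ENNReal.ofReal_le_ofReal_iff hl0, ofReal_integral_eq_lintegral_ofReal hW hW0]
  exact lintegral_ofReal_le_of_tendsto_ae hZ (fun n => ae_of_all _ (hZ0 n)) hlim
    (Eventually.of_forall he) hl

/-- A convergent sequence in `L²` has an almost everywhere convergent subsequence. -/
theorem exists_subseq_tendsto_ae_of_tendsto_Lp {α : Type*} [MeasurableSpace α] {μ : Measure α}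
    {v : ℕ → Lp ℝ 2 μ} {w : Lp ℝ 2 μ} (h : Tendsto v atTop (𝓝 w)) :
    ∃ ns : ℕ → ℕ, StrictMono ns ∧
      ∀ᵐ z ∂μ, Tendsto (fun n => v (ns n) z) atTop (𝓝 (w z)) :=
  (tendstoInMeasure_of_tendsto_Lp h).exists_seq_tendsto_ae

theorem integral_sq_eq_norm_sq {α : Type*} [MeasurableSpace α] {μ : Measure α} (v : Lp ℝ 2 μ) :
    ∫ z, v z ^ 2 ∂μ = ‖v‖ ^ 2 := by
  rw [← real_inner_self_eq_norm_sq, L2.inner_def]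
  refine integral_congr_ae (ae_of_all _ fun z => ?_)
  change v z ^ 2 = v z * v z
  ring

theorem abs_le_mul_abs_of_deriv_le {G : ℝ → ℝ} (hG : Differentiable ℝ G) (hG0 : G 0 = 0) {B : ℝ}
    (h0 : ∀ x, 0 ≤ deriv G x) (hB : ∀ x, deriv G x ≤ B) (x : ℝ) : |G x| ≤ B * |x| := by
  have := Convex.norm_image_sub_le_of_norm_deriv_le (f := G) (s := Set.univ) (x := 0) (y := x)
    (C := B) (fun y _ => hG y) (fun y _ => by
      rw [Real.norm_eq_abs, abs_of_nonneg (h0 y)]; exact hB y) convex_univ trivial trivial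
  simpa [hG0] using this

namespace SymmetricDiffusion

section Resolvent

variable {E : Type*} [NormedAddCommGroup E] [NormedSpace ℝ E] [FiniteDimensional ℝ E]
  {M : Type*} [TopologicalSpace M] [ChartedSpace E M] [IsManifold 𝓘(ℝ, E) ∞ M]
  [T2Space M] [SigmaCompactSpace M] [MeasurableSpace M] [BorelSpace M]
  {μ : Measure M} [IsFiniteMeasureOnCompacts μ] (D : SymmetricDiffusion E μ)

theorem hasCompactSupport_L {f : C^∞⟮𝓘(ℝ, E), M; ℝ⟯} (hf : HasCompactSupport f) :
    HasCompactSupport (D.L f) :=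
  hf.of_isClosed_subset (isClosed_tsupport _) (D.tsupport_L_subset f)

omit [FiniteDimensional ℝ E] [IsManifold 𝓘(ℝ, E) ∞ M] [T2Space M] [SigmaCompactSpace M] in
theorem integrable_of_hasCompactSupport {f : C^∞⟮𝓘(ℝ, E), M; ℝ⟯} (hf : HasCompactSupport f) :
    Integrable f μ :=
  f.contMDiff.continuous.integrable_of_hasCompactSupport hf

/-- `∫ L f dμ = 0`: test `L f` against a cutoff function equal to one near the support of `f`. -/
theorem integral_L_eq_zero {f : C^∞⟮𝓘(ℝ, E), M; ℝ⟯} (hf : HasCompactSupport f) :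
    ∫ z, D.L f z ∂μ = 0 := by
  have : LocallyCompactSpace M := ChartedSpace.locallyCompactSpace E M
  obtain ⟨K, hK, hfK⟩ := exists_compact_superset (K := tsupport f) hf
  obtain ⟨χ, h1, h0, -⟩ := exists_contMDiffMap_one_nhds_of_subset_interior 𝓘(ℝ, E) (n := ⊤)
    (isClosed_tsupport f) hfK
  have hχ : HasCompactSupport χ := HasCompactSupport.intro hK fun z hz => h0 z hz
  have e1 : ∀ z, D.L f z = χ z * D.L f z := by
    intro z
    by_cases hz : z ∈ tsupport f
    · rw [h1.self_of_nhdsSet z hz, one_mul]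
    · have : D.L f z = 0 := image_eq_zero_of_notMem_tsupport fun h => hz (D.tsupport_L_subset f h)
      rw [this, mul_zero]
  have e2 : ∀ z, f z * D.L χ z = 0 := by
    intro z
    by_cases hz : z ∈ tsupport f
    · rw [D.L_eq_zero_of_eventually_one χ z (h1.filter_mono (nhds_le_nhdsSet hz)), mul_zero]
    · rw [image_eq_zero_of_notMem_tsupport hz, zero_mul]
  rw [integral_congr_ae (ae_of_all _ e1), D.symm χ f hχ hf, integral_congr_ae (ae_of_all _ e2),
    integral_zero]

theorem hasCompactSupport_Γ {f : C^∞⟮𝓘(ℝ, E), M; ℝ⟯} (hf : HasCompactSupport f)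
    (g : C^∞⟮𝓘(ℝ, E), M; ℝ⟯) : HasCompactSupport (D.Γ f g) := by
  refine HasCompactSupport.intro (K := tsupport f) hf fun z hz => ?_
  exact D.Γ_eq_zero_of_eventually_zero f g z (notMem_tsupport_iff_eventuallyEq.1 hz)

/-- Integration by parts. -/
theorem integral_Γ {f g : C^∞⟮𝓘(ℝ, E), M; ℝ⟯} (hf : HasCompactSupport f)
    (hg : HasCompactSupport g) : ∫ z, D.Γ f g z ∂μ = -∫ z, f z * D.L g z ∂μ := by
  have hfg : HasCompactSupport (f * g) := HasCompactSupport.mul_right hf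
  have i1 : Integrable (fun z => D.L (f * g) z) μ :=
    integrable_of_hasCompactSupport (D.hasCompactSupport_L hfg)
  have i2 : Integrable (fun z => f z * D.L g z) μ :=
    integrable_of_hasCompactSupport (f := f * D.L g) (HasCompactSupport.mul_right hf)
  have i3 : Integrable (fun z => g z * D.L f z) μ :=
    integrable_of_hasCompactSupport (f := g * D.L f) (HasCompactSupport.mul_right hg)
  have e : ∀ z, D.Γ f g z = (1 / 2) * (D.L (f * g) z - f z * D.L g z - g z * D.L f z) :=
    fun z => rfl
  have i4 : Integrable (fun z => D.L (f * g) z - f z * D.L g z) μ := i1.sub i2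
  rw [integral_congr_ae (ae_of_all _ e), integral_const_mul, integral_sub i4 i3,
    integral_sub i1 i2, D.integral_L_eq_zero hfg, D.symm g f hg hf]
  ring

theorem TestFunction.inner_eq {h : ℝ≥0} (φ ψ : TestFunction D h) :
    inner ℝ φ ψ = ∫ z, φ.1 z * ψ.1 z ∂μ + h * ∫ z, D.Γ φ.1 ψ.1 z ∂μ := by
  rw [TestFunction.inner_def, D.integral_Γ φ.2 ψ.2]
  ring

theorem TestFunction.norm_sq_eq {h : ℝ≥0} (φ : TestFunction D h) :
    ‖φ‖ ^ 2 = ∫ z, φ.1 z ^ 2 ∂μ + h * ∫ z, D.Γ φ.1 φ.1 z ∂μ := by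
  rw [← real_inner_self_eq_norm_sq, TestFunction.inner_eq]
  simp only [sq]

omit [FiniteDimensional ℝ E] [IsManifold 𝓘(ℝ, E) ∞ M] [T2Space M] [SigmaCompactSpace M] in
theorem TestFunction.coeFn_toL2 {h : ℝ≥0} (φ : TestFunction D h) :
    TestFunction.toL2 D h φ =ᵐ[μ] φ.1 := φ.memLp_two.coeFn_toLp

theorem analyticOnNhd_exp : AnalyticOnNhd ℝ Real.exp Set.univ := fun _ _ => analyticAt_rexp

/-- The smooth weight `e^η`. -/
noncomputable def expWeight (η : C^∞⟮𝓘(ℝ, E), M; ℝ⟯) : C^∞⟮𝓘(ℝ, E), M; ℝ⟯ :=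
  postcomp Real.exp Real.contDiff_exp η

/-- The test function `G(φ) e^η`. -/
noncomputable def testWith {h : ℝ≥0} (G : ℝ → ℝ) (hG : ContDiff ℝ ∞ G) (hG0 : G 0 = 0)
    (η : C^∞⟮𝓘(ℝ, E), M; ℝ⟯) (φ : TestFunction D h) : TestFunction D h :=
  ⟨postcomp G hG φ.1 * expWeight η,
    HasCompactSupport.mul_right (HasCompactSupport.comp_left (g := G) φ.2 hG0)⟩

section

variable {h : ℝ≥0} {G : ℝ → ℝ} (hG : AnalyticOnNhd ℝ G Set.univ) (hGs : ContDiff ℝ ∞ G)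
  (hG0 : G 0 = 0) {η : C^∞⟮𝓘(ℝ, E), M; ℝ⟯} {A B c : ℝ}

include hG in
/-- The functions `G(φ) e^η` are bounded in the form norm by `φ`. -/
theorem norm_testWith_sq_le (hη : ∀ z, η z ≤ 0) (hA0 : 0 ≤ A) (hA : ∀ z, D.Γ η η z ≤ A)
    (h0 : ∀ x, 0 ≤ deriv G x) (hB : ∀ x, deriv G x ≤ B) (φ : TestFunction D h) :
    ‖D.testWith G hGs hG0 η φ‖ ^ 2 ≤ 2 * B ^ 2 * (1 + h * A) * ‖φ‖ ^ 2 := by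
  have hGB := abs_le_mul_abs_of_deriv_le (hGs.differentiable (by simp)) hG0 h0 hB
  have iφ : Integrable (fun z => φ.1 z ^ 2) μ := by
    simpa only [sq] using φ.integrable_mul φ.1
  have iΓ : Integrable (fun z => D.Γ φ.1 φ.1 z) μ :=
    integrable_of_hasCompactSupport (D.hasCompactSupport_Γ φ.2 _)
  set ψ := D.testWith G hGs hG0 η φ
  have iψ : Integrable (fun z => ψ.1 z ^ 2) μ := by
    simpa only [sq] using ψ.integrable_mul ψ.1
  have iΓψ : Integrable (fun z => D.Γ ψ.1 ψ.1 z) μ :=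
    integrable_of_hasCompactSupport (D.hasCompactSupport_Γ ψ.2 _)
  have hm : ∀ z, Real.exp (η z) ^ 2 ≤ 1 := fun z => by
    have : Real.exp (η z) ≤ 1 := Real.exp_le_one_iff.2 (hη z)
    exact pow_le_one₀ (Real.exp_pos _).le this
  have hGsq : ∀ x, G x ^ 2 ≤ B ^ 2 * x ^ 2 := fun x => by
    rw [← sq_abs (G x), ← sq_abs x, ← mul_pow]
    exact pow_le_pow_left₀ (abs_nonneg _) (hGB x) 2
  have b1 : ∫ z, ψ.1 z ^ 2 ∂μ ≤ B ^ 2 * ∫ z, φ.1 z ^ 2 ∂μ := by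
    rw [← integral_const_mul]
    refine integral_mono iψ (iφ.const_mul _) fun z => ?_
    change (G (φ.1 z) * Real.exp (η z)) ^ 2 ≤ B ^ 2 * φ.1 z ^ 2
    rw [mul_pow]
    exact (mul_le_of_le_one_right (sq_nonneg _) (hm z)).trans (hGsq _)
  have b2 : ∫ z, D.Γ ψ.1 ψ.1 z ∂μ ≤
      2 * B ^ 2 * ∫ z, D.Γ φ.1 φ.1 z ∂μ + 2 * B ^ 2 * A * ∫ z, φ.1 z ^ 2 ∂μ := by
    rw [← integral_const_mul, ← integral_const_mul,
      ← integral_add (iΓ.const_mul _) (iφ.const_mul _)]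
    refine integral_mono iΓψ ((iΓ.const_mul _).add (iφ.const_mul _)) fun z => ?_
    refine (D.Γ_mul_self_le _ _ z).trans ?_
    rw [expWeight, Γ_postcomp_self D _ _ analyticOnNhd_exp, Γ_postcomp_self D _ _ hG,
      Real.deriv_exp]
    simp only [postcomp_apply]
    have p1 := D.Γ_self_nonneg φ.1 z
    have p2 := D.Γ_self_nonneg η z
    have t1 : G (φ.1 z) ^ 2 * (Real.exp (η z) ^ 2 * D.Γ η η z) ≤ (B ^ 2 * φ.1 z ^ 2) * (1 * A) :=
      mul_le_mul (hGsq _) (mul_le_mul (hm z) (hA z) p2 zero_le_one) (by positivity) (by positivity)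
    have t2 : Real.exp (η z) ^ 2 * (deriv G (φ.1 z) ^ 2 * D.Γ φ.1 φ.1 z) ≤
        1 * (B ^ 2 * D.Γ φ.1 φ.1 z) :=
      mul_le_mul (hm z) (mul_le_mul_of_nonneg_right (pow_le_pow_left₀ (h0 _) (hB _) 2) p1)
        (by positivity) zero_le_one
    linarith
  have hΓ0 : 0 ≤ ∫ z, D.Γ φ.1 φ.1 z ∂μ := integral_nonneg fun z => D.Γ_self_nonneg _ z
  have hφ0 : 0 ≤ ∫ z, φ.1 z ^ 2 ∂μ := integral_nonneg fun z => sq_nonneg _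
  rw [TestFunction.norm_sq_eq, TestFunction.norm_sq_eq]
  have hh : (0 : ℝ) ≤ h := h.2
  have b3 := mul_le_mul_of_nonneg_left b2 hh
  have n1 : 0 ≤ B ^ 2 * ∫ z, φ.1 z ^ 2 ∂μ := by positivity
  have n2 : 0 ≤ B ^ 2 * (h * A) * (h * ∫ z, D.Γ φ.1 φ.1 z ∂μ) := by positivity
  nlinarith

include hG in
/-- Completion of the square in `Γ(φ, G(φ) e^η) = (G'(φ) Γ(φ) + G(φ) Γ(φ, η)) e^η`. -/
theorem Γ_testWith_ge (hc : ∀ x, 0 < deriv G x) (φ : TestFunction D h) (z : M) :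
    -(1 / 4 * D.Γ η η z * (G (φ.1 z) ^ 2 / deriv G (φ.1 z))) * Real.exp (η z) ≤
      D.Γ φ.1 (D.testWith G hGs hG0 η φ).1 z := by
  have e : D.Γ φ.1 (D.testWith G hGs hG0 η φ).1 z =
      (deriv G (φ.1 z) * D.Γ φ.1 φ.1 z + G (φ.1 z) * D.Γ φ.1 η z) * Real.exp (η z) := by
    rw [testWith, Γ_mul_right, D.Γ_comm φ.1 (expWeight η), expWeight,
      Γ_postcomp_left D _ _ _ analyticOnNhd_exp, D.Γ_comm φ.1 (postcomp G hGs φ.1),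
      Γ_postcomp_left D _ _ _ hG, Real.deriv_exp, D.Γ_comm η]
    simp only [postcomp_apply]
    ring
  rw [e]
  refine mul_le_mul_of_nonneg_right ?_ (Real.exp_pos _).le
  have hd := hc (φ.1 z)
  have q := D.Γ_self_nonneg (φ.1 + (G (φ.1 z) / (2 * deriv G (φ.1 z))) • η) z
  rw [Γ_quadratic] at q
  have q2 := mul_nonneg hd.le q
  have e2 : deriv G (φ.1 z) * (D.Γ φ.1 φ.1 z +
        2 * (G (φ.1 z) / (2 * deriv G (φ.1 z))) * D.Γ φ.1 η z +
        (G (φ.1 z) / (2 * deriv G (φ.1 z))) ^ 2 * D.Γ η η z) =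
      deriv G (φ.1 z) * D.Γ φ.1 φ.1 z + G (φ.1 z) * D.Γ φ.1 η z +
        1 / 4 * D.Γ η η z * (G (φ.1 z) ^ 2 / deriv G (φ.1 z)) := by
    field_simp
    ring
  rw [e2] at q2
  linarith

end

/-- The resolvent equation `u - h L u = f` tested against `G(u) e^η`. The elements of the form
domain are only limits of test functions `φ`; the functions `G(φ) e^η` are bounded in the form norm,
which lets one pass to the limit without any chain rule in the form domain. -/
theorem integral_resolvent_le (h : ℝ≥0) (f : Lp ℝ 2 μ) {G : ℝ → ℝ}
    (hG : AnalyticOnNhd ℝ G Set.univ) (hG0 : G 0 = 0) {c B : ℝ} (hc : 0 < c)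
    (hcG : ∀ x, c ≤ deriv G x) (hB : ∀ x, deriv G x ≤ B)
    (η : C^∞⟮𝓘(ℝ, E), M; ℝ⟯) (hη : ∀ z, η z ≤ 0) {A : ℝ} (hA0 : 0 ≤ A)
    (hA : ∀ z, D.Γ η η z ≤ A) :
    ∫ z, (D.resolvent h f z * G (D.resolvent h f z) -
      h / 4 * D.Γ η η z * (G (D.resolvent h f z) ^ 2 / deriv G (D.resolvent h f z)) -
      f z * G (D.resolvent h f z)) * Real.exp (η z) ∂μ ≤ 0 := by
  have hGs : ContDiff ℝ ∞ G := contDiff_iff_contDiffAt.2 fun x => (hG x trivial).contDiffAt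
  have h0 : ∀ x, 0 < deriv G x := fun x => hc.trans_le (hcG x)
  have hB0 : 0 < B := (h0 0).trans_le (hB 0)
  have hGB := abs_le_mul_abs_of_deriv_le (hGs.differentiable (by simp)) hG0 (fun x => (h0 x).le) hB
  have hGc : Continuous G := hGs.continuous
  have hdc : Continuous (deriv G) := hGs.continuous_deriv (by simp)
  have hh : (0 : ℝ) ≤ h := h.2
  set U := (formDomainToL2 D h).adjoint f with hU
  set u : Lp ℝ 2 μ := D.resolvent h f with hu
  have huU : formDomainToL2 D h U = u := rfl
  -- approximation of the solution by test functions
  obtain ⟨φ, hφ⟩ : ∃ φ : ℕ → TestFunction D h,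
      Tendsto (fun n => (φ n : FormDomain D h)) atTop (𝓝 U) := by
    have := UniformSpace.Completion.denseRange_coe (α := TestFunction D h) U
    obtain ⟨s, hs, hs2⟩ := mem_closure_iff_seq_limit.1 this
    choose φ hφ using hs
    exact ⟨φ, by simpa only [hφ] using hs2⟩
  have hφ2 : Tendsto (fun n => TestFunction.toL2 D h (φ n)) atTop (𝓝 u) := by
    have := ((formDomainToL2 D h).continuous.tendsto U).comp hφ
    simpa only [Function.comp_def, formDomainToL2_coe, huU] using this
  -- the integrand as a function of the value of the solution
  set F : M → ℝ → ℝ := fun z x => (x * G x - h / 4 * D.Γ η η z * (G x ^ 2 / deriv G x) -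
      f z * G x) * Real.exp (η z) with hF
  set C : ℝ := B + h / 4 * A * (B ^ 2 / c) + B with hC
  have hC0 : 0 ≤ C := by positivity
  have hFb : ∀ z x, |F z x| ≤ C * (x ^ 2 + f z ^ 2) := by
    intro z x
    have g0 := D.Γ_self_nonneg η z
    have t1 : |x * G x| ≤ B * x ^ 2 := by
      rw [abs_mul, ← sq_abs]
      nlinarith [hGB x, abs_nonneg x]
    have t2 : |h / 4 * D.Γ η η z * (G x ^ 2 / deriv G x)| ≤ h / 4 * A * (B ^ 2 / c) * x ^ 2 := by
      have k : G x ^ 2 / deriv G x ≤ B ^ 2 * x ^ 2 / c := by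
        refine div_le_div₀ (by positivity) ?_ hc (hcG x)
        rw [← sq_abs (G x), ← sq_abs x, ← mul_pow]
        exact pow_le_pow_left₀ (abs_nonneg _) (hGB x) 2
      have k0 : 0 ≤ G x ^ 2 / deriv G x := div_nonneg (sq_nonneg _) (h0 x).le
      rw [abs_of_nonneg (by positivity)]
      calc h / 4 * D.Γ η η z * (G x ^ 2 / deriv G x) ≤ h / 4 * A * (B ^ 2 * x ^ 2 / c) :=
            mul_le_mul (mul_le_mul_of_nonneg_left (hA z) (by positivity)) k k0 (by positivity)
        _ = _ := by ring
    have t3 : |f z * G x| ≤ B * (x ^ 2 + f z ^ 2) := by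
      rw [abs_mul, ← sq_abs x, ← sq_abs (f z)]
      have := mul_le_mul_of_nonneg_left (hGB x) (abs_nonneg (f z))
      nlinarith [sq_nonneg (|x| - |f z|), abs_nonneg x, abs_nonneg (f z),
        mul_nonneg hB0.le (sq_nonneg (|x| - |f z|)), mul_nonneg hB0.le (sq_nonneg |x|),
        mul_nonneg hB0.le (sq_nonneg |f z|)]
    have hm1 : Real.exp (η z) ≤ 1 := Real.exp_le_one_iff.2 (hη z)
    have s : |x * G x - h / 4 * D.Γ η η z * (G x ^ 2 / deriv G x) - f z * G x| ≤
        C * (x ^ 2 + f z ^ 2) := by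
      refine (abs_sub _ _).trans ((add_le_add ((abs_sub _ _).trans (add_le_add t1 t2)) t3).trans ?_)
      have : 0 ≤ (B + h / 4 * A * (B ^ 2 / c)) * f z ^ 2 := by positivity
      rw [hC]
      nlinarith
    rw [hF]
    simp only
    rw [abs_mul, abs_of_pos (Real.exp_pos _)]
    exact (mul_le_of_le_one_right (abs_nonneg _) hm1).trans s
  have hFcont : ∀ z, Continuous (F z) := by
    intro z
    have : Continuous fun x => G x ^ 2 / deriv G x := (hGc.pow 2).div hdc fun x => (h0 x).ne'
    fun_prop
  have ifsq : Integrable (fun z => f z ^ 2) μ := (Lp.memLp f).integrable_sq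
  have hFmeas : ∀ v : M → ℝ, AEStronglyMeasurable v μ →
      AEStronglyMeasurable (fun z => F z (v z)) μ := by
    intro v hv
    have k1 : Continuous fun x => G x ^ 2 / deriv G x := (hGc.pow 2).div hdc fun x => (h0 x).ne'
    have k2 : AEStronglyMeasurable (fun z => D.Γ η η z) μ :=
      (D.Γ η η).contMDiff.continuous.aestronglyMeasurable
    have k3 : AEStronglyMeasurable (fun z => Real.exp (η z)) μ :=
      (Real.continuous_exp.comp η.contMDiff.continuous).aestronglyMeasurable
    exact ((((hv.mul (hGc.comp_aestronglyMeasurable hv)).sub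
      ((k2.const_mul _).mul (k1.comp_aestronglyMeasurable hv))).sub
      ((Lp.aestronglyMeasurable f).mul (hGc.comp_aestronglyMeasurable hv))).mul k3)
  have hFint : ∀ v : M → ℝ, AEStronglyMeasurable v μ → Integrable (fun z => v z ^ 2) μ →
      Integrable (fun z => F z (v z)) μ := fun v hv hv2 =>
    ((hv2.add ifsq).const_mul C).mono' (hFmeas v hv) (ae_of_all _ fun z => hFb z (v z))
  -- the test functions `G(φ) e^η`
  set ψ : ℕ → TestFunction D h := fun n => D.testWith G hGs hG0 η (φ n) with hψ
  have hsub : Tendsto (fun n => inner ℝ ((φ n : FormDomain D h) - U) (ψ n : FormDomain D h)) atTop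
      (𝓝 0) := by
    have b : ∀ n, ‖(ψ n : FormDomain D h)‖ ≤
        Real.sqrt (2 * B ^ 2 * (1 + h * A)) * ‖(φ n : FormDomain D h)‖ := by
      intro n
      rw [UniformSpace.Completion.norm_coe, UniformSpace.Completion.norm_coe]
      refine (sq_le_sq₀ (norm_nonneg _) (by positivity)).1 ?_
      rw [mul_pow, Real.sq_sqrt (by positivity)]
      exact D.norm_testWith_sq_le hG hGs hG0 hη hA0 hA (fun x => (h0 x).le) hB (φ n)
    have t1 : Tendsto (fun n => ‖(φ n : FormDomain D h) - U‖ *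
        (Real.sqrt (2 * B ^ 2 * (1 + h * A)) * ‖(φ n : FormDomain D h)‖)) atTop (𝓝 0) := by
      have a1 : Tendsto (fun n => ‖(φ n : FormDomain D h) - U‖) atTop (𝓝 0) :=
        tendsto_iff_norm_sub_tendsto_zero.1 hφ
      have a2 := a1.mul (hφ.norm.const_mul (Real.sqrt (2 * B ^ 2 * (1 + h * A))))
      rwa [zero_mul] at a2
    refine squeeze_zero_norm (fun n => ?_) t1
    exact (norm_inner_le_norm _ _).trans (mul_le_mul_of_nonneg_left (b n) (norm_nonneg _))
  have iφsq : ∀ n, Integrable (fun z => (φ n).1 z ^ 2) μ := fun n => by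
    simpa only [sq] using (φ n).integrable_mul (φ n).1
  have hφm : ∀ n, AEStronglyMeasurable (fun z => (φ n).1 z) μ :=
    fun n => (φ n).continuous.aestronglyMeasurable
  have hFφ : ∀ n, ∫ z, F z ((φ n).1 z) ∂μ ≤
      inner ℝ ((φ n : FormDomain D h) - U) (ψ n : FormDomain D h) := by
    intro n
    have e1 : inner ℝ U (ψ n : FormDomain D h) = ∫ z, f z * (ψ n).1 z ∂μ := by
      rw [hU, ContinuousLinearMap.adjoint_inner_left, formDomainToL2_coe, L2.inner_def]
      refine integral_congr_ae ?_
      filter_upwards [TestFunction.coeFn_toL2 D (ψ n)] with z hz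
      rw [hz]
      exact mul_comm _ _
    have e2 : inner ℝ (φ n : FormDomain D h) (ψ n : FormDomain D h) =
        ∫ z, (φ n).1 z * (ψ n).1 z ∂μ + h * ∫ z, D.Γ (φ n).1 (ψ n).1 z ∂μ := by
      rw [UniformSpace.Completion.inner_coe, TestFunction.inner_eq]
    have i1 : Integrable (fun z => (φ n).1 z * (ψ n).1 z) μ := (φ n).integrable_mul _
    have i2 : Integrable (fun z => D.Γ (φ n).1 (ψ n).1 z) μ :=
      integrable_of_hasCompactSupport (D.hasCompactSupport_Γ (φ n).2 _)
    have i3 : Integrable (fun z => f z * (ψ n).1 z) μ :=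
      MemLp.integrable_mul (Lp.memLp f) (ψ n).memLp_two
    have i4 : Integrable (fun z => (φ n).1 z * (ψ n).1 z + h * D.Γ (φ n).1 (ψ n).1 z) μ :=
      i1.add (i2.const_mul _)
    rw [inner_sub_left, e1, e2, ← integral_const_mul, ← integral_add i1 (i2.const_mul _),
      ← integral_sub i4 i3]
    refine integral_mono (hFint _ (hφm n) (iφsq n)) (i4.sub i3) fun z => ?_
    have k := mul_le_mul_of_nonneg_left (D.Γ_testWith_ge hG hGs hG0 (η := η) h0 (φ n) z) hh
    have k2 : (ψ n).1 z = G ((φ n).1 z) * Real.exp (η z) := rfl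
    simp only [hF, k2]
    linarith
  -- the integrand has no sign, so `C (φ² + f²)`, whose integral converges, is added before Fatou
  obtain ⟨ns, hns, hae⟩ := exists_subseq_tendsto_ae_of_tendsto_Lp hφ2
  have iusq : Integrable (fun z => u z ^ 2) μ := (Lp.memLp u).integrable_sq
  have iFu : Integrable (fun z => F z (u z)) μ := hFint _ (Lp.aestronglyMeasurable u) iusq
  have iW : Integrable (fun z => F z (u z) + C * (u z ^ 2 + f z ^ 2)) μ :=
    iFu.add ((iusq.add ifsq).const_mul C)
  have key := integral_le_of_tendsto_ae_of_nonneg (μ := μ)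
    (Z := fun n z => F z ((φ (ns n)).1 z) + C * ((φ (ns n)).1 z ^ 2 + f z ^ 2))
    (W := fun z => F z (u z) + C * (u z ^ 2 + f z ^ 2))
    (e := fun n => inner ℝ ((φ (ns n) : FormDomain D h) - U) (ψ (ns n) : FormDomain D h) +
      C * (‖TestFunction.toL2 D h (φ (ns n))‖ ^ 2 + ∫ z, f z ^ 2 ∂μ))
    (l := 0 + C * (‖u‖ ^ 2 + ∫ z, f z ^ 2 ∂μ))
    (fun n => (hFint _ (hφm _) (iφsq _)).add (((iφsq _).add ifsq).const_mul C))
    (fun n z => by linarith [neg_abs_le (F z ((φ (ns n)).1 z)), hFb z ((φ (ns n)).1 z)])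
    iW ?_ ?_ ?_
  · have e3 : ∫ z, (F z (u z) + C * (u z ^ 2 + f z ^ 2)) ∂μ =
        ∫ z, F z (u z) ∂μ + C * (‖u‖ ^ 2 + ∫ z, f z ^ 2 ∂μ) := by
      have i5 : Integrable (fun z => C * (u z ^ 2 + f z ^ 2)) μ := (iusq.add ifsq).const_mul C
      rw [integral_add iFu i5, integral_const_mul,
        integral_add iusq ifsq, integral_sq_eq_norm_sq]
    rw [e3] at key
    linarith
  · have hall : ∀ᵐ z ∂μ, ∀ n, TestFunction.toL2 D h (φ n) z = (φ n).1 z :=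
      ae_all_iff.2 fun n => TestFunction.coeFn_toL2 D (φ n)
    filter_upwards [hae, hall] with z hz hz2
    simp only [hz2] at hz
    exact (((hFcont z).tendsto _).comp hz).add (((hz.pow 2).add_const _).const_mul C)
  · intro n
    have e3 : ∫ z, (F z ((φ (ns n)).1 z) + C * ((φ (ns n)).1 z ^ 2 + f z ^ 2)) ∂μ =
        ∫ z, F z ((φ (ns n)).1 z) ∂μ +
          C * (‖TestFunction.toL2 D h (φ (ns n))‖ ^ 2 + ∫ z, f z ^ 2 ∂μ) := by
      have i5 : Integrable (fun z => C * ((φ (ns n)).1 z ^ 2 + f z ^ 2)) μ :=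
        ((iφsq _).add ifsq).const_mul C
      rw [integral_add (hFint _ (hφm _) (iφsq _)) i5,
        integral_const_mul, integral_add (iφsq _) ifsq, ← integral_sq_eq_norm_sq]
      congr 3
      refine integral_congr_ae ?_
      filter_upwards [TestFunction.coeFn_toL2 D (φ (ns n))] with z hz
      rw [hz]
    rw [e3]
    have := hFφ (ns n)
    linarith
  · exact (hsub.comp hns.tendsto_atTop).add
      ((((hφ2.comp hns.tendsto_atTop).norm.pow 2).add_const _).const_mul C)

end Resolvent

end SymmetricDiffusion

/-! ### The resolvent is sub-Markovian -/

theorem AnalyticAt.rpow_const_of_pos {f : ℝ → ℝ} {x : ℝ} (hf : AnalyticAt ℝ f x) (h0 : ∀ y, 0 < f y)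
    (a : ℝ) : AnalyticAt ℝ (fun y => f y ^ a) x := by
  have : (fun y => f y ^ a) = fun y => Real.exp (Real.log (f y) * a) :=
    funext fun y => Real.rpow_def_of_pos (h0 y) a
  rw [this]
  exact ((hf.log (h0 x)).mul analyticAt_const).rexp

/-- The regularization `s_ε(x - C) - s_ε(-C) + ε x` of the positive part of `x - C`, where
`s_ε(x) = (x + √(x² + ε²)) / 2`. It vanishes at zero, and its derivative lies in `[ε, 1 + ε]`. -/
noncomputable def smoothPosPart (C ε x : ℝ) : ℝ :=
  ((x - C) + √((x - C) ^ 2 + ε ^ 2)) / 2 - (-C + √(C ^ 2 + ε ^ 2)) / 2 + ε * x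

theorem smoothPosPart_zero (C ε : ℝ) : smoothPosPart C ε 0 = 0 := by
  simp [smoothPosPart]

theorem analyticOnNhd_smoothPosPart (C : ℝ) {ε : ℝ} (hε : 0 < ε) :
    AnalyticOnNhd ℝ (smoothPosPart C ε) Set.univ := by
  intro x _
  have h0 : ∀ y : ℝ, 0 < (y - C) ^ 2 + ε ^ 2 := fun y => by positivity
  have h1 : AnalyticAt ℝ (fun y : ℝ => (y - C) ^ 2 + ε ^ 2) x :=
    ((analyticAt_id.sub analyticAt_const).pow 2).add analyticAt_const
  have h2 : AnalyticAt ℝ (fun y : ℝ => √((y - C) ^ 2 + ε ^ 2)) x := by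
    simp only [Real.sqrt_eq_rpow]
    exact h1.rpow_const_of_pos h0 _
  exact (((((analyticAt_id.sub analyticAt_const).add h2).div_const).sub analyticAt_const).add
    (analyticAt_const.mul analyticAt_id))

theorem hasDerivAt_smoothPosPart (C : ℝ) {ε : ℝ} (hε : 0 < ε) (x : ℝ) :
    HasDerivAt (smoothPosPart C ε)
      ((1 + (x - C) / √((x - C) ^ 2 + ε ^ 2)) / 2 + ε) x := by
  have h0 : (x - C) ^ 2 + ε ^ 2 ≠ 0 := by positivity
  have h1 : HasDerivAt (fun y : ℝ => y - C) 1 x := (hasDerivAt_id x).sub_const C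
  have h2 := (((h1.pow 2).add_const (ε ^ 2)).sqrt h0)
  have h3 := ((((h1.add h2).div_const 2).sub_const ((-C + √(C ^ 2 + ε ^ 2)) / 2)).add
    ((hasDerivAt_id x).const_mul ε))
  refine h3.congr_deriv ?_
  simp only [Pi.pow_apply, Nat.cast_ofNat, Nat.add_one_sub_one, pow_one, mul_one]
  rw [mul_div_mul_left _ _ two_ne_zero]

theorem deriv_smoothPosPart_mem (C : ℝ) {ε : ℝ} (hε : 0 < ε) (x : ℝ) :
    ε ≤ deriv (smoothPosPart C ε) x ∧ deriv (smoothPosPart C ε) x ≤ 1 + ε := by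
  rw [(hasDerivAt_smoothPosPart C hε x).deriv]
  have h0 : 0 < √((x - C) ^ 2 + ε ^ 2) := Real.sqrt_pos.2 (by positivity)
  have h1 : |x - C| ≤ √((x - C) ^ 2 + ε ^ 2) :=
    Real.abs_le_sqrt (by linarith [sq_nonneg ε])
  have h2 : |(x - C) / √((x - C) ^ 2 + ε ^ 2)| ≤ 1 := by
    rw [abs_div, abs_of_pos h0]
    exact div_le_one_of_le₀ h1 h0.le
  have := abs_le.1 h2
  constructor <;> linarith

theorem tendsto_smoothPosPart {C : ℝ} (hC : 0 ≤ C) (x : ℝ) :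
    Tendsto (fun ε => smoothPosPart C ε x) (𝓝 0) (𝓝 (max (x - C) 0)) := by
  have hc : Continuous fun ε => smoothPosPart C ε x := by
    unfold smoothPosPart
    fun_prop
  have := hc.tendsto 0
  have e : smoothPosPart C 0 x = max (x - C) 0 := by
    simp only [smoothPosPart, ne_eq, OfNat.ofNat_ne_zero, not_false_eq_true, zero_pow, add_zero,
      Real.sqrt_sq_eq_abs, abs_of_nonneg hC]
    rcases le_total (x - C) 0 with h | h
    · rw [abs_of_nonpos h, max_eq_right h]; ring
    · rw [abs_of_nonneg h, max_eq_left h]; ring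
  rwa [e] at this

namespace SymmetricDiffusion

section Markov

variable {E : Type*} [NormedAddCommGroup E] [NormedSpace ℝ E] [FiniteDimensional ℝ E]
  {M : Type*} [TopologicalSpace M] [ChartedSpace E M] [IsManifold 𝓘(ℝ, E) ∞ M]
  [T2Space M] [SigmaCompactSpace M] [MeasurableSpace M] [BorelSpace M]
  {μ : Measure M} [IsFiniteMeasureOnCompacts μ] (D : SymmetricDiffusion E μ)

/-- The resolvent preserves upper bounds: test `u - h L u = f` with `(u - C)₊`. -/
theorem resolvent_le_of_le (h : ℝ≥0) {f : Lp ℝ 2 μ} {C : ℝ} (hC : 0 ≤ C) (hf : ∀ᵐ z ∂μ, f z ≤ C) :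
    ∀ᵐ z ∂μ, D.resolvent h f z ≤ C := by
  set u := D.resolvent h f with hu
  have hΓ : ∀ z, D.Γ (0 : C^∞⟮𝓘(ℝ, E), M; ℝ⟯) 0 z = 0 := fun z => by
    rw [Γ_zero_left]; rfl
  have i1 : Integrable (fun z => u z ^ 2) μ := (Lp.memLp u).integrable_sq
  have i2 : Integrable (fun z => f z ^ 2) μ := (Lp.memLp f).integrable_sq
  set ε : ℕ → ℝ := fun n => 1 / ((n : ℝ) + 1) with hε
  have hε0 : ∀ n, 0 < ε n := fun n => by positivity
  have hε1 : ∀ n, ε n ≤ 1 := fun n => by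
    rw [hε]
    exact div_le_one_of_le₀ (by linarith [(Nat.cast_nonneg n : (0 : ℝ) ≤ n)]) (by positivity)
  have hεt : Tendsto ε atTop (𝓝 0) := tendsto_one_div_add_atTop_nhds_zero_nat
  have step : ∀ n, ∫ z, (u z - f z) * smoothPosPart C (ε n) (u z) ∂μ ≤ 0 := by
    intro n
    have := D.integral_resolvent_le h f (analyticOnNhd_smoothPosPart C (hε0 n))
      (smoothPosPart_zero C _) (hε0 n) (fun x => (deriv_smoothPosPart_mem C (hε0 n) x).1)
      (fun x => (deriv_smoothPosPart_mem C (hε0 n) x).2) 0 (fun z => le_rfl) le_rfl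
      (fun z => (hΓ z).le)
    refine le_of_eq_of_le (integral_congr_ae (ae_of_all _ fun z => ?_)) this
    simp only [hΓ, mul_zero, zero_mul, sub_zero]
    change _ = _ * Real.exp 0
    rw [Real.exp_zero, mul_one, sub_mul]
  have hb : ∀ n x, |smoothPosPart C (ε n) x| ≤ 2 * |x| := by
    intro n x
    have h1 := deriv_smoothPosPart_mem C (hε0 n)
    refine (abs_le_mul_abs_of_deriv_le
      (fun y => (hasDerivAt_smoothPosPart C (hε0 n) y).differentiableAt) (smoothPosPart_zero C _)
      (fun y => (hε0 n).le.trans (h1 y).1) (fun y => (h1 y).2) x).trans ?_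
    exact mul_le_mul_of_nonneg_right (by linarith [hε1 n]) (abs_nonneg x)
  have hlim : Tendsto (fun n => ∫ z, (u z - f z) * smoothPosPart C (ε n) (u z) ∂μ) atTop
      (𝓝 (∫ z, (u z - f z) * max (u z - C) 0 ∂μ)) := by
    refine tendsto_integral_of_dominated_convergence
      (fun z => 2 * (2 * u z ^ 2 + f z ^ 2)) (fun n => ?_)
      (((i1.const_mul 2).add i2).const_mul 2) (fun n => ae_of_all _ fun z => ?_)
      (ae_of_all _ fun z => ?_)
    · have hc : Continuous (smoothPosPart C (ε n)) := by unfold smoothPosPart; fun_prop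
      exact ((Lp.aestronglyMeasurable u).sub (Lp.aestronglyMeasurable f)).mul
        (hc.comp_aestronglyMeasurable (Lp.aestronglyMeasurable u))
    · rw [Real.norm_eq_abs, abs_mul]
      have k1 : |u z - f z| ≤ |u z| + |f z| := abs_sub _ _
      have k2 := mul_le_mul k1 (hb n (u z)) (abs_nonneg _) (by positivity)
      refine k2.trans ?_
      rw [← sq_abs (u z), ← sq_abs (f z)]
      nlinarith [sq_nonneg (|u z| - |f z|)]
    · exact ((tendsto_smoothPosPart hC (u z)).comp hεt).const_mul _
  have hle : ∫ z, (u z - f z) * max (u z - C) 0 ∂μ ≤ 0 := le_of_tendsto' hlim step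
  have hpt : ∀ᵐ z ∂μ, max (u z - C) 0 ^ 2 ≤ (u z - f z) * max (u z - C) 0 := by
    filter_upwards [hf] with z hz
    rw [sq]
    rcases le_total (u z - C) 0 with k | k
    · rw [max_eq_right k]; simp
    · rw [max_eq_left k]
      exact mul_le_mul_of_nonneg_right (by linarith) k
  have i3 : Integrable (fun z => (u z - f z) * max (u z - C) 0) μ := by
    refine (((i1.const_mul 2).add i2).const_mul 2).mono' ?_ (ae_of_all _ fun z => ?_)
    · have hc : Continuous fun x : ℝ => max (x - C) 0 := by fun_prop
      exact ((Lp.aestronglyMeasurable u).sub (Lp.aestronglyMeasurable f)).mul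
        (hc.comp_aestronglyMeasurable (Lp.aestronglyMeasurable u))
    · have k0 : |max (u z - C) 0| ≤ |u z| := by
        rw [abs_of_nonneg (le_max_right _ _)]
        exact max_le (by linarith [le_abs_self (u z)]) (abs_nonneg _)
      rw [Real.norm_eq_abs, abs_mul]
      refine (mul_le_mul (abs_sub _ _) k0 (abs_nonneg _) (by positivity)).trans ?_
      change _ ≤ 2 * (2 * u z ^ 2 + f z ^ 2)
      rw [← sq_abs (u z), ← sq_abs (f z)]
      nlinarith [sq_nonneg (|u z| - |f z|)]
  have hnn : 0 ≤ᵐ[μ] fun z => (u z - f z) * max (u z - C) 0 := by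
    filter_upwards [hpt] with z hz using (sq_nonneg _).trans hz
  have h0 := (integral_eq_zero_iff_of_nonneg_ae hnn i3).1 (le_antisymm hle (integral_nonneg_of_ae hnn))
  filter_upwards [hpt, h0] with z h1 h2
  have h3 : max (u z - C) 0 ^ 2 ≤ 0 := h1.trans h2.le
  have h4 : max (u z - C) 0 = 0 := pow_eq_zero_iff two_ne_zero |>.1 (le_antisymm h3 (sq_nonneg _))
  linarith [le_max_left (u z - C) 0]

theorem resolvent_nonneg (h : ℝ≥0) {f : Lp ℝ 2 μ} (hf : ∀ᵐ z ∂μ, 0 ≤ f z) :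
    ∀ᵐ z ∂μ, 0 ≤ D.resolvent h f z := by
  have h1 : ∀ᵐ z ∂μ, (-f) z ≤ 0 := by
    filter_upwards [hf, Lp.coeFn_neg f] with z h1 h2
    rw [h2]
    exact neg_nonpos.2 h1
  have h2 := D.resolvent_le_of_le h le_rfl h1
  rw [map_neg] at h2
  filter_upwards [h2, Lp.coeFn_neg (D.resolvent h f)] with z h3 h4
  rw [h4] at h3
  exact neg_nonpos.1 h3

/-- The resolvent preserves integrability of nonnegative functions: by symmetry
`∫_K R f = ∫ f R 1_K ≤ ∫ f` for `K` compact. -/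
theorem integrable_resolvent (h : ℝ≥0) {f : Lp ℝ 2 μ} (hf : ∀ᵐ z ∂μ, 0 ≤ f z)
    (hfi : Integrable f μ) : Integrable (D.resolvent h f) μ := by
  have hK : ∀ n, IsCompact (compactCovering M n) := isCompact_compactCovering M
  have hcov : AECover μ atTop (compactCovering M) :=
    { ae_eventually_mem := ae_of_all _ fun z => by
        obtain ⟨n, hn⟩ := exists_mem_compactCovering z
        filter_upwards [eventually_ge_atTop n] with m hm
        exact compactCovering_subset M hm hn
      measurableSet := fun n => (hK n).measurableSet }
  refine hcov.integrable_of_integral_bounded_of_nonneg_ae (∫ z, f z ∂μ) (fun n => ?_)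
    (D.resolvent_nonneg h hf) (Eventually.of_forall fun n => ?_)
  · have : IsFiniteMeasure (μ.restrict (compactCovering M n)) :=
      ⟨by simpa using (hK n).measure_lt_top⟩
    exact ((Lp.memLp (D.resolvent h f)).restrict _).integrable (by norm_num)
  · set k : Lp ℝ 2 μ := indicatorConstLp 2 (hK n).measurableSet (hK n).measure_lt_top.ne 1 with hk
    have hk1 : ∀ᵐ z ∂μ, k z ≤ 1 := by
      filter_upwards [indicatorConstLp_coeFn (p := 2) (hs := (hK n).measurableSet)
        (hμs := (hK n).measure_lt_top.ne) (c := (1 : ℝ))] with z hz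
      rw [hk, hz]
      exact Set.indicator_le_self' (fun _ _ => zero_le_one) z |>.trans le_rfl
    have e : ∫ z in compactCovering M n, D.resolvent h f z ∂μ = inner ℝ f (D.resolvent h k) := by
      rw [← L2.inner_indicatorConstLp_one (𝕜 := ℝ) (hK n).measurableSet (hK n).measure_lt_top.ne,
        ← ContinuousLinearMap.adjoint_inner_left, ← ContinuousLinearMap.star_eq_adjoint,
        resolvent_adjoint, real_inner_comm]
    rw [e, L2.inner_def]
    have ii : Integrable (fun z => inner ℝ (f z) (D.resolvent h k z)) μ := L2.integrable_inner f _
    refine integral_mono_ae ii hfi ?_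
    filter_upwards [hf, D.resolvent_le_of_le h zero_le_one hk1] with z h1 h2
    change D.resolvent h k z * f z ≤ f z
    exact mul_le_of_le_one_left h1 h2

end Markov

end SymmetricDiffusion

/-! ### Regularized powers -/

/-- The quantity `(x² + ε²) / (1 + ε² x²)`, which regularizes `x²` at zero and at infinity. -/
noncomputable def regSq (ε x : ℝ) : ℝ := (x ^ 2 + ε ^ 2) / (1 + ε ^ 2 * x ^ 2)

/-- The regularization `x ((x² + ε²) / (1 + ε² x²)) ^ ((p - 2) / 2)` of `x ^ (p - 1)`. For all `p > 1`
it is analytic and its derivative is bounded above and bounded away from zero. -/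
noncomputable def regPow (p ε x : ℝ) : ℝ := x * regSq ε x ^ ((p - 2) / 2)

/-- Half the logarithmic derivative `x r' / r` of `r = regSq ε`, a number in `[0, 1]`; the derivative
of `regPow` is `r ^ ((p - 2) / 2) * (1 + (p - 2) * regRatio ε x)`. -/
noncomputable def regRatio (ε x : ℝ) : ℝ :=
  x ^ 2 * (1 - ε ^ 4) / ((x ^ 2 + ε ^ 2) * (1 + ε ^ 2 * x ^ 2))

section RegPow

variable {p ε : ℝ}

theorem regSq_pos (hε : 0 < ε) (x : ℝ) : 0 < regSq ε x := by unfold regSq; positivity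

theorem regPow_zero (p ε : ℝ) : regPow p ε 0 = 0 := zero_mul _

theorem regPow_nonneg (hε : 0 < ε) {x : ℝ} (hx : 0 ≤ x) : 0 ≤ regPow p ε x :=
  mul_nonneg hx (Real.rpow_nonneg (regSq_pos hε x).le _)

theorem analyticOnNhd_regPow (p : ℝ) (hε : 0 < ε) : AnalyticOnNhd ℝ (regPow p ε) Set.univ := by
  intro x _
  refine analyticAt_id.mul (AnalyticAt.rpow_const_of_pos ?_ (regSq_pos hε) _)
  exact ((analyticAt_id.pow 2).add analyticAt_const).div
    (analyticAt_const.add (analyticAt_const.mul (analyticAt_id.pow 2))) (by positivity)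

theorem hasDerivAt_regPow (p : ℝ) (hε : 0 < ε) (x : ℝ) : HasDerivAt (regPow p ε)
    (regSq ε x ^ ((p - 2) / 2) * (1 + (p - 2) * regRatio ε x)) x := by
  have h0 : 0 < x ^ 2 + ε ^ 2 := by positivity
  have h1 : 0 < 1 + ε ^ 2 * x ^ 2 := by positivity
  have d1 : HasDerivAt (fun y : ℝ => y ^ 2) (2 * x) x := by simpa using hasDerivAt_pow 2 x
  have d2 := (d1.add_const (ε ^ 2)).div ((d1.const_mul (ε ^ 2)).const_add 1) h1.ne'
  have d3 := (hasDerivAt_id x).mul (d2.rpow_const (p := (p - 2) / 2) (Or.inl (regSq_pos hε x).ne'))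
  refine d3.congr_deriv ?_
  have e : ((fun y : ℝ => y ^ 2 + ε ^ 2) / (fun y : ℝ => 1 + ε ^ 2 * y ^ 2) : ℝ → ℝ) x =
      regSq ε x := rfl
  rw [e, Real.rpow_sub_one (regSq_pos hε x).ne', regRatio]
  simp only [id]
  rw [show regSq ε x ^ ((p - 2) / 2) / regSq ε x =
    regSq ε x ^ ((p - 2) / 2) * ((1 + ε ^ 2 * x ^ 2) / (x ^ 2 + ε ^ 2)) by
      rw [div_eq_mul_inv, regSq, inv_div]]
  field_simp
  ring

theorem regRatio_nonneg (hε : 0 < ε) (hε1 : ε ≤ 1) (x : ℝ) : 0 ≤ regRatio ε x := by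
  have : ε ^ 4 ≤ 1 := pow_le_one₀ hε.le hε1
  exact div_nonneg (mul_nonneg (sq_nonneg x) (by linarith)) (by positivity)

theorem regRatio_le_one (hε : 0 < ε) (x : ℝ) : regRatio ε x ≤ 1 := by
  refine div_le_one_of_le₀ ?_ (by positivity)
  have : 0 ≤ ε ^ 2 + ε ^ 2 * x ^ 4 + 2 * ε ^ 4 * x ^ 2 := by positivity
  nlinarith

theorem min_le_one_add_mul_regRatio (hε : 0 < ε) (hε1 : ε ≤ 1) (p x : ℝ) :
    min 1 (p - 1) ≤ 1 + (p - 2) * regRatio ε x := by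
  have h0 := regRatio_nonneg hε hε1 x
  have h1 := regRatio_le_one hε x
  have a := mul_le_mul_of_nonneg_right (min_le_left 1 (p - 1)) (sub_nonneg.2 h1)
  have b := mul_le_mul_of_nonneg_right (min_le_right 1 (p - 1)) h0
  linarith

theorem one_add_mul_regRatio_le_max (hε : 0 < ε) (hε1 : ε ≤ 1) (p x : ℝ) :
    1 + (p - 2) * regRatio ε x ≤ max 1 (p - 1) := by
  have h0 := regRatio_nonneg hε hε1 x
  have h1 := regRatio_le_one hε x
  have a := mul_le_mul_of_nonneg_right (le_max_left 1 (p - 1)) (sub_nonneg.2 h1)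
  have b := mul_le_mul_of_nonneg_right (le_max_right 1 (p - 1)) h0
  linarith

theorem rpow_mem_Icc_of_mem_Icc {m b r : ℝ} (a : ℝ) (hm : 0 < m) (h1 : m ≤ r) (h2 : r ≤ b) :
    min (m ^ a) (b ^ a) ≤ r ^ a ∧ r ^ a ≤ max (m ^ a) (b ^ a) := by
  have hr := hm.trans_le h1
  rcases le_total 0 a with ha | ha
  · exact ⟨min_le_of_left_le (Real.rpow_le_rpow hm.le h1 ha),
      le_max_of_le_right (Real.rpow_le_rpow hr.le h2 ha)⟩
  · exact ⟨min_le_of_right_le (Real.rpow_le_rpow_of_nonpos hr h2 ha),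
      le_max_of_le_left (Real.rpow_le_rpow_of_nonpos hm h1 ha)⟩

theorem exists_deriv_regPow_bounds (hp : 1 < p) (hε : 0 < ε) (hε1 : ε ≤ 1) :
    ∃ c B : ℝ, 0 < c ∧ (∀ x, c ≤ deriv (regPow p ε) x) ∧ ∀ x, deriv (regPow p ε) x ≤ B := by
  have hb : ∀ x, ε ^ 2 ≤ regSq ε x ∧ regSq ε x ≤ (ε ^ 2)⁻¹ := by
    intro x
    have h4 : ε ^ 4 ≤ 1 := pow_le_one₀ hε.le hε1
    have h1 : 0 < 1 + ε ^ 2 * x ^ 2 := by positivity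
    constructor
    · rw [regSq, le_div_iff₀ h1]
      nlinarith [sq_nonneg x]
    · rw [regSq, div_le_iff₀ h1, ← div_eq_inv_mul, le_div_iff₀ (by positivity)]
      nlinarith [sq_nonneg x]
  have hr := fun x => rpow_mem_Icc_of_mem_Icc ((p - 2) / 2) (by positivity) (hb x).1 (hb x).2
  have hm : 0 < min 1 (p - 1) := lt_min one_pos (by linarith)
  refine ⟨min ((ε ^ 2) ^ ((p - 2) / 2)) ((ε ^ 2)⁻¹ ^ ((p - 2) / 2)) * min 1 (p - 1),
    max ((ε ^ 2) ^ ((p - 2) / 2)) ((ε ^ 2)⁻¹ ^ ((p - 2) / 2)) * max 1 (p - 1),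
    mul_pos (lt_min (by positivity) (by positivity)) hm, fun x => ?_, fun x => ?_⟩
  · rw [(hasDerivAt_regPow p hε x).deriv]
    exact mul_le_mul (hr x).1 (min_le_one_add_mul_regRatio hε hε1 p x) hm.le
      (Real.rpow_nonneg (regSq_pos hε x).le _)
  · rw [(hasDerivAt_regPow p hε x).deriv]
    exact mul_le_mul (hr x).2 (one_add_mul_regRatio_le_max hε hε1 p x)
      (hm.le.trans (min_le_one_add_mul_regRatio hε hε1 p x))
      ((Real.rpow_nonneg (regSq_pos hε x).le _).trans (hr x).2)

theorem regPow_sq_div_deriv (hε : 0 < ε) (p x : ℝ) :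
    regPow p ε x ^ 2 / deriv (regPow p ε) x =
      x * regPow p ε x / (1 + (p - 2) * regRatio ε x) := by
  have h := Real.rpow_pos_of_pos (regSq_pos hε x) ((p - 2) / 2)
  rw [(hasDerivAt_regPow p hε x).deriv, regPow, mul_pow,
    show x ^ 2 * (regSq ε x ^ ((p - 2) / 2)) ^ 2 =
      regSq ε x ^ ((p - 2) / 2) * (x * (x * regSq ε x ^ ((p - 2) / 2))) by ring,
    mul_div_mul_left _ _ h.ne']

/-- A bound for `regPow p ε` on `[0, C]` that is uniform in `ε`. -/
theorem exists_regPow_le (hp : 1 < p) {C : ℝ} (hC : 0 ≤ C) :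
    ∃ B : ℝ, 0 ≤ B ∧ ∀ ε, 0 < ε → ε ≤ 1 → ∀ x, 0 ≤ x → x ≤ C → regPow p ε x ≤ B := by
  set d : ℝ := 1 + C ^ 2 with hd
  have hd0 : 0 < d := by positivity
  refine ⟨max (C * d ^ ((p - 2) / 2)) (C ^ (p - 1) / d ^ ((p - 2) / 2)),
    le_max_of_le_left (mul_nonneg hC (Real.rpow_nonneg hd0.le _)), fun ε hε hε1 x hx hxC => ?_⟩
  have hε2 : ε ^ 2 ≤ 1 := pow_le_one₀ hε.le hε1
  have hxC2 : x ^ 2 ≤ C ^ 2 := pow_le_pow_left₀ hx hxC 2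
  have hb : 0 < 1 + ε ^ 2 * x ^ 2 := by positivity
  rcases le_total 0 ((p - 2) / 2) with ha | ha
  · refine le_max_of_le_left (mul_le_mul hxC ?_ (Real.rpow_nonneg (regSq_pos hε x).le _) hC)
    refine Real.rpow_le_rpow (regSq_pos hε x).le ?_ ha
    rw [regSq, div_le_iff₀ hb]
    have : 0 ≤ d * (ε ^ 2 * x ^ 2) := by positivity
    nlinarith
  · refine le_max_of_le_right ?_
    rcases hx.eq_or_lt with rfl | hx0
    · rw [regPow_zero]
      exact div_nonneg (Real.rpow_nonneg hC _) (Real.rpow_nonneg hd0.le _)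
    · have h1 : x ^ 2 / d ≤ regSq ε x := by
        rw [regSq, div_le_div_iff₀ hd0 hb]
        have k1 : ε ^ 2 * x ^ 2 ≤ C ^ 2 := by nlinarith [sq_nonneg x]
        have k2 : x ^ 2 * (1 + ε ^ 2 * x ^ 2) ≤ x ^ 2 * d :=
          mul_le_mul_of_nonneg_left (by linarith) (sq_nonneg x)
        have k3 : 0 ≤ ε ^ 2 * d := by positivity
        linarith
      have h2 : regSq ε x ^ ((p - 2) / 2) ≤ (x ^ 2 / d) ^ ((p - 2) / 2) :=
        Real.rpow_le_rpow_of_nonpos (by positivity) h1 ha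
      have h3 : (x ^ 2) ^ ((p - 2) / 2) = x ^ (p - 2) := by
        rw [← Real.rpow_natCast, ← Real.rpow_mul hx]
        congr 1
        push_cast
        ring
      calc regPow p ε x ≤ x * (x ^ 2 / d) ^ ((p - 2) / 2) := mul_le_mul_of_nonneg_left h2 hx
        _ = x ^ (p - 1) / d ^ ((p - 2) / 2) := by
          rw [Real.div_rpow (sq_nonneg x) hd0.le, h3, ← mul_div_assoc,
            show p - 1 = 1 + (p - 2) by ring, Real.rpow_add hx0, Real.rpow_one]
        _ ≤ _ := div_le_div_of_nonneg_right (Real.rpow_le_rpow hx hxC (by linarith))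
          (Real.rpow_nonneg hd0.le _)

theorem tendsto_regPow (hp : 1 < p) {x : ℝ} (hx : 0 ≤ x) :
    Tendsto (fun ε => regPow p ε x) (𝓝 0) (𝓝 (x ^ (p - 1))) := by
  rcases hx.eq_or_lt with rfl | hx0
  · simp only [regPow_zero]
    rw [Real.zero_rpow (by linarith)]
    exact tendsto_const_nhds
  · have h1 : ContinuousAt (fun ε => regSq ε x) 0 := by
      have : Continuous fun ε : ℝ => (x ^ 2 + ε ^ 2) / (1 + ε ^ 2 * x ^ 2) :=
        Continuous.div (by fun_prop) (by fun_prop) fun ε => by positivity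
      exact this.continuousAt
    have e : regSq 0 x = x ^ 2 := by simp [regSq]
    have h2 := (h1.rpow_const (p := (p - 2) / 2) (Or.inl (by rw [e]; positivity))).const_mul x
    have h3 : x * regSq 0 x ^ ((p - 2) / 2) = x ^ (p - 1) := by
      rw [e, ← Real.rpow_natCast, ← Real.rpow_mul hx, show p - 1 = 1 + (p - 2) by ring,
        Real.rpow_add hx0, Real.rpow_one]
      congr 2
      push_cast
      ring
    rw [← h3]
    exact h2

theorem tendsto_regPow_sq_div_deriv (hp : 1 < p) {x : ℝ} (hx : 0 ≤ x) {ε : ℕ → ℝ}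
    (hε : ∀ n, 0 < ε n) (hε0 : Tendsto ε atTop (𝓝 0)) :
    Tendsto (fun n => regPow p (ε n) x ^ 2 / deriv (regPow p (ε n)) x) atTop
      (𝓝 (x ^ p / (p - 1))) := by
  simp only [regPow_sq_div_deriv (hε _)]
  rcases hx.eq_or_lt with rfl | hx0
  · simp only [zero_mul, zero_div]
    rw [Real.zero_rpow (by linarith), zero_div]
    exact tendsto_const_nhds
  · have hc : ContinuousAt (fun ε : ℝ => regRatio ε x) 0 := by
      unfold regRatio
      refine ContinuousAt.div (by fun_prop) (by fun_prop) ?_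
      simp only [ne_eq, OfNat.ofNat_ne_zero, not_false_eq_true, zero_pow]
      positivity
    have e : regRatio 0 x = 1 := by
      simp only [regRatio, ne_eq, OfNat.ofNat_ne_zero, not_false_eq_true, zero_pow, sub_zero,
        mul_one, add_zero, zero_mul]
      exact div_self (by positivity)
    have h1 : Tendsto (fun n => 1 + (p - 2) * regRatio (ε n) x) atTop (𝓝 (p - 1)) := by
      have := (((hc.tendsto.comp hε0).const_mul (p - 2)).const_add 1)
      rw [e, show 1 + (p - 2) * 1 = p - 1 by ring] at this
      exact this
    have h2 := (((tendsto_regPow hp hx).comp hε0).const_mul x).div h1 (by linarith)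
    have e2 : x * x ^ (p - 1) = x ^ p := by
      rw [← Real.rpow_one_add' hx (by linarith)]
      congr 1
      ring
    rwa [e2] at h2

end RegPow

namespace SymmetricDiffusion

section Power

variable {E : Type*} [NormedAddCommGroup E] [NormedSpace ℝ E] [FiniteDimensional ℝ E]
  {M : Type*} [TopologicalSpace M] [ChartedSpace E M] [IsManifold 𝓘(ℝ, E) ∞ M]
  [T2Space M] [SigmaCompactSpace M] [MeasurableSpace M] [BorelSpace M]
  {μ : Measure M} [IsFiniteMeasureOnCompacts μ] (D : SymmetricDiffusion E μ)

theorem integrable_rpow_mul_exp {p C : ℝ} (hp : 1 < p) {v : M → ℝ} (hv : Integrable v μ)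
    (hv0 : ∀ᵐ z ∂μ, 0 ≤ v z) (hvC : ∀ᵐ z ∂μ, v z ≤ C) {η : M → ℝ} (hη : Continuous η)
    (hη0 : ∀ z, η z ≤ 0) : Integrable (fun z => v z ^ p * Real.exp (η z)) μ := by
  refine (hv.const_mul (C ^ (p - 1))).mono' ?_ ?_
  · exact ((Real.continuous_rpow_const (by linarith)).comp_aestronglyMeasurable
      hv.aestronglyMeasurable).mul (Real.continuous_exp.comp hη).aestronglyMeasurable
  · filter_upwards [hv0, hvC] with z h0 hC
    have h1 : 0 ≤ v z ^ p := Real.rpow_nonneg h0 _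
    rw [Real.norm_eq_abs, abs_of_nonneg (mul_nonneg h1 (Real.exp_pos _).le)]
    refine (mul_le_of_le_one_right h1 (Real.exp_le_one_iff.2 (hη0 z))).trans ?_
    have e : v z ^ p = v z ^ (p - 1) * v z := by
      rw [← Real.rpow_add_one' h0 (by linarith)]
      congr 1
      ring
    rw [e]
    exact mul_le_mul_of_nonneg_right (Real.rpow_le_rpow h0 hC (by linarith)) h0

/-- The resolvent equation `u - h L u = f` tested against `u ^ (p - 1) e^η`, after completing the
square. -/
theorem integral_resolvent_rpow_le (h : ℝ≥0) {f : Lp ℝ 2 μ} {p C : ℝ} (hp : 1 < p) (hC : 0 ≤ C)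
    (hf0 : ∀ᵐ z ∂μ, 0 ≤ f z) (hfC : ∀ᵐ z ∂μ, f z ≤ C) (hfi : Integrable f μ)
    (η : C^∞⟮𝓘(ℝ, E), M; ℝ⟯) (hη : ∀ z, η z ≤ 0) {A : ℝ} (hA0 : 0 ≤ A)
    (hA : ∀ z, D.Γ η η z ≤ A) :
    Integrable (fun z => (D.resolvent h f z ^ p -
      h / 4 * D.Γ η η z * (D.resolvent h f z ^ p / (p - 1)) -
      f z * D.resolvent h f z ^ (p - 1)) * Real.exp (η z)) μ ∧
    ∫ z, (D.resolvent h f z ^ p - h / 4 * D.Γ η η z * (D.resolvent h f z ^ p / (p - 1)) -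
      f z * D.resolvent h f z ^ (p - 1)) * Real.exp (η z) ∂μ ≤ 0 := by
  set u := D.resolvent h f with hu
  have hu0 := D.resolvent_nonneg h hf0
  have huC := D.resolvent_le_of_le h hC hfC
  have hui := D.integrable_resolvent h hf0 hfi
  rw [← hu] at hu0 huC hui
  have hh : (0 : ℝ) ≤ h := h.2
  obtain ⟨B, hB0, hB⟩ := exists_regPow_le hp hC
  set ε : ℕ → ℝ := fun n => 1 / ((n : ℝ) + 1) with hε
  have hε0 : ∀ n, 0 < ε n := fun n => by positivity
  have hε1 : ∀ n, ε n ≤ 1 := fun n => by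
    rw [hε]
    exact div_le_one_of_le₀ (by linarith [(Nat.cast_nonneg n : (0 : ℝ) ≤ n)]) (by positivity)
  have hεt : Tendsto ε atTop (𝓝 0) := tendsto_one_div_add_atTop_nhds_zero_nat
  set k : ℝ := min 1 (p - 1) with hk
  have hk0 : 0 < k := lt_min one_pos (by linarith)
  set F : ℕ → M → ℝ := fun n z => (u z * regPow p (ε n) (u z) -
      h / 4 * D.Γ η η z * (regPow p (ε n) (u z) ^ 2 / deriv (regPow p (ε n)) (u z)) -
      f z * regPow p (ε n) (u z)) * Real.exp (η z) with hF
  set W : M → ℝ := fun z => (u z ^ p - h / 4 * D.Γ η η z * (u z ^ p / (p - 1)) -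
      f z * u z ^ (p - 1)) * Real.exp (η z) with hW
  have step : ∀ n, ∫ z, F n z ∂μ ≤ 0 := by
    intro n
    obtain ⟨c, b, hc, h1, h2⟩ := exists_deriv_regPow_bounds hp (hε0 n) (hε1 n)
    exact D.integral_resolvent_le h f (analyticOnNhd_regPow p (hε0 n)) (regPow_zero p _) hc h1 h2
      η hη hA0 hA
  have hlim : ∀ᵐ z ∂μ, Tendsto (fun n => F n z) atTop (𝓝 (W z)) := by
    filter_upwards [hu0] with z h0
    have t1 := (tendsto_regPow hp h0).comp hεt
    have t2 := tendsto_regPow_sq_div_deriv hp h0 hε0 hεt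
    have e2 : u z * u z ^ (p - 1) = u z ^ p := by
      rw [← Real.rpow_one_add' h0 (by linarith)]
      congr 1
      ring
    have t3 := (((t1.const_mul (u z)).sub (t2.const_mul (h / 4 * D.Γ η η z))).sub
      (t1.const_mul (f z))).mul_const (Real.exp (η z))
    rw [e2] at t3
    exact t3
  have hmeas : ∀ n, AEStronglyMeasurable (F n) μ := by
    intro n
    have ha := analyticOnNhd_regPow p (hε0 n)
    have hs : ContDiff ℝ ∞ (regPow p (ε n)) :=
      contDiff_iff_contDiffAt.2 fun x => (ha x trivial).contDiffAt
    obtain ⟨c, b, hc, h1, h2⟩ := exists_deriv_regPow_bounds hp (hε0 n) (hε1 n)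
    have k1 : Continuous fun x => regPow p (ε n) x ^ 2 / deriv (regPow p (ε n)) x :=
      (hs.continuous.pow 2).div (hs.continuous_deriv (by simp)) fun x => (hc.trans_le (h1 x)).ne'
    have k2 : AEStronglyMeasurable (fun z => D.Γ η η z) μ :=
      (D.Γ η η).contMDiff.continuous.aestronglyMeasurable
    have k3 : AEStronglyMeasurable (fun z => Real.exp (η z)) μ :=
      (Real.continuous_exp.comp η.contMDiff.continuous).aestronglyMeasurable
    have hv := Lp.aestronglyMeasurable u
    exact ((((hv.mul (hs.continuous.comp_aestronglyMeasurable hv)).sub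
      ((k2.const_mul _).mul (k1.comp_aestronglyMeasurable hv))).sub
      ((Lp.aestronglyMeasurable f).mul (hs.continuous.comp_aestronglyMeasurable hv))).mul k3)
  set G : M → ℝ := fun z => B * u z + h / 4 * A * (B / k * u z) + B * f z with hG
  have hGi : Integrable G μ :=
    ((hui.const_mul B).add ((hui.const_mul (B / k)).const_mul _)).add (hfi.const_mul B)
  have hbound : ∀ n, ∀ᵐ z ∂μ, ‖F n z‖ ≤ G z := by
    intro n
    filter_upwards [hu0, huC, hf0] with z h0 hC' hf
    have b0 := regPow_nonneg (p := p) (hε0 n) h0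
    have b1 := hB (ε n) (hε0 n) (hε1 n) (u z) h0 hC'
    have g0 := D.Γ_self_nonneg η z
    have m0 := min_le_one_add_mul_regRatio (hε0 n) (hε1 n) p (u z)
    have t1 : |u z * regPow p (ε n) (u z)| ≤ B * u z := by
      rw [abs_of_nonneg (mul_nonneg h0 b0), mul_comm]
      exact mul_le_mul_of_nonneg_right b1 h0
    have t2 : |h / 4 * D.Γ η η z * (regPow p (ε n) (u z) ^ 2 / deriv (regPow p (ε n)) (u z))| ≤
        h / 4 * A * (B / k * u z) := by
      rw [regPow_sq_div_deriv (hε0 n)]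
      have q0 : 0 ≤ u z * regPow p (ε n) (u z) / (1 + (p - 2) * regRatio (ε n) (u z)) :=
        div_nonneg (mul_nonneg h0 b0) (hk0.le.trans m0)
      rw [abs_of_nonneg (by positivity)]
      refine mul_le_mul (mul_le_mul_of_nonneg_left (hA z) (by positivity)) ?_ q0 (by positivity)
      rw [div_mul_eq_mul_div]
      refine div_le_div₀ (by positivity) ?_ hk0 m0
      rw [mul_comm]
      exact mul_le_mul_of_nonneg_right b1 h0
    have t3 : |f z * regPow p (ε n) (u z)| ≤ B * f z := by
      rw [abs_of_nonneg (mul_nonneg hf b0), mul_comm]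
      exact mul_le_mul_of_nonneg_right b1 hf
    rw [Real.norm_eq_abs, abs_mul, abs_of_pos (Real.exp_pos _)]
    refine (mul_le_of_le_one_right (abs_nonneg _) (Real.exp_le_one_iff.2 (hη z))).trans ?_
    exact (abs_sub _ _).trans (add_le_add ((abs_sub _ _).trans (add_le_add t1 t2)) t3)
  have hall : ∀ᵐ z ∂μ, ∀ n, ‖F n z‖ ≤ G z := ae_all_iff.2 hbound
  refine ⟨hGi.mono' (aestronglyMeasurable_of_tendsto_ae atTop hmeas hlim) ?_,
    le_of_tendsto' (tendsto_integral_of_dominated_convergence G hmeas hGi hbound hlim) step⟩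
  filter_upwards [hall, hlim] with z h1 h2 using le_of_tendsto' h2.norm h1

end Power

end SymmetricDiffusion

/-! ### The weighted inequality for a smooth distance function -/

/-- The constant of the error `stepError * h²` made in one resolvent step of size `h`. -/
noncomputable def stepError (p q τ R : ℝ) : ℝ :=
  q ^ 2 * R ^ 2 / (2 * τ ^ 3) + q ^ 2 * R ^ 4 / (4 * (p - 1) * τ ^ 4)

theorem stepError_nonneg {p q τ R : ℝ} (hp : 1 < p) (hτ : 0 < τ) : 0 ≤ stepError p q τ R := by
  have : 0 < p - 1 := by linarith
  unfold stepError
  positivity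

theorem exp_neg_le {y : ℝ} (hy : 0 ≤ y) : Real.exp (-y) ≤ 1 - y + y ^ 2 := by
  have h1 : 1 + y ≤ Real.exp y := by linarith [Real.add_one_le_exp y]
  rw [Real.exp_neg]
  refine (inv_anti₀ (by linarith) h1).trans ?_
  rw [inv_le_iff_one_le_mul₀ (by linarith)]
  nlinarith [pow_nonneg hy 3]

/-- The choice `q = p / (2 (p - 1))` makes the decrease `δ` of the weight exponent compensate the
term `h γ / (4 (p - 1))`, where `γ = Γ(η)`, up to second order in `h`. -/
theorem one_sub_stepError_le {p q τ τ₁ h R s γ δ : ℝ} (hp : 1 < p) (hq : q = p / (2 * (p - 1)))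
    (hτ : 0 < τ) (hτ₁ : τ ≤ τ₁) (hh : 0 ≤ h) (hs : 0 ≤ s) (hsR : s ≤ R ^ 2)
    (hγ : γ ≤ s / τ₁ ^ 2) (hδ : δ = s / (2 * τ₁) - s / (2 * (τ₁ + q * h))) :
    1 - stepError p q τ R * h ^ 2 ≤
      p * (1 - h / 4 * γ / (p - 1) - (1 - 1 / p) * Real.exp (-(δ / (p - 1)))) := by
  have hp1 : 0 < p - 1 := by linarith
  have hp0 : 0 < p := by linarith
  have hq0 : 0 < q := by rw [hq]; positivity
  have hτ₁0 : 0 < τ₁ := hτ.trans_le hτ₁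
  have hqh : 0 ≤ q * h := by positivity
  set τ₀ := τ₁ + q * h with hτ₀
  have hτ₀τ : τ ≤ τ₀ := by linarith
  have hτ₀0 : 0 < τ₀ := by linarith
  have hδ2 : δ = s * (q * h) / (2 * τ₀ * τ₁) := by
    rw [hδ]
    field_simp
    rw [hτ₀]
    ring
  have hδ0 : 0 ≤ δ := by rw [hδ2]; positivity
  have e1 : (1 - 1 / p) * p = p - 1 := by field_simp
  have e2 : p * (h / 4 * γ / (p - 1)) = q / 2 * h * γ := by
    rw [hq]; field_simp; ring
  have hy := exp_neg_le (div_nonneg hδ0 hp1.le)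
  have e3 : (p - 1) * (1 - δ / (p - 1) + (δ / (p - 1)) ^ 2) = (p - 1) - δ + δ ^ 2 / (p - 1) := by
    field_simp
  have b1 : p * (1 - h / 4 * γ / (p - 1) - (1 - 1 / p) * Real.exp (-(δ / (p - 1)))) ≥
      1 - q / 2 * h * γ + δ - δ ^ 2 / (p - 1) := by
    have := mul_le_mul_of_nonneg_left hy hp1.le
    rw [e3] at this
    have e4 : p * (1 - h / 4 * γ / (p - 1) - (1 - 1 / p) * Real.exp (-(δ / (p - 1)))) =
        p - p * (h / 4 * γ / (p - 1)) - ((1 - 1 / p) * p) * Real.exp (-(δ / (p - 1))) := by ring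
    rw [e4, e1, e2]
    linarith
  have b2 : q / 2 * h * γ - δ ≤ q ^ 2 * R ^ 2 / (2 * τ ^ 3) * h ^ 2 := by
    have k1 : q / 2 * h * γ ≤ q / 2 * h * (s / τ₁ ^ 2) :=
      mul_le_mul_of_nonneg_left hγ (by positivity)
    have k2 : q / 2 * h * (s / τ₁ ^ 2) - δ = (q ^ 2 * h ^ 2 * s) / (2 * (τ₀ * τ₁ ^ 2)) := by
      rw [hδ2]
      field_simp
      rw [hτ₀]
      ring
    have k3 : (q ^ 2 * h ^ 2 * s) / (2 * (τ₀ * τ₁ ^ 2)) ≤ (q ^ 2 * h ^ 2 * R ^ 2) / (2 * τ ^ 3) := by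
      refine div_le_div₀ (by positivity) (by gcongr) (by positivity) ?_
      have : τ ^ 3 = τ * τ ^ 2 := by ring
      rw [this]
      gcongr
    calc _ ≤ q / 2 * h * (s / τ₁ ^ 2) - δ := by linarith
      _ ≤ _ := k2.le.trans k3
      _ = _ := by ring
  have b3 : δ ^ 2 / (p - 1) ≤ q ^ 2 * R ^ 4 / (4 * (p - 1) * τ ^ 4) * h ^ 2 := by
    have k1 : δ ≤ R ^ 2 * (q * h) / (2 * τ * τ) := by
      rw [hδ2]
      gcongr
    have k2 := pow_le_pow_left₀ hδ0 k1 2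
    calc δ ^ 2 / (p - 1) ≤ (R ^ 2 * (q * h) / (2 * τ * τ)) ^ 2 / (p - 1) := by gcongr
      _ = _ := by field_simp; ring
  have : stepError p q τ R * h ^ 2 = q ^ 2 * R ^ 2 / (2 * τ ^ 3) * h ^ 2 +
      q ^ 2 * R ^ 4 / (4 * (p - 1) * τ ^ 4) * h ^ 2 := by rw [stepError]; ring
  linarith

/-- Young's inequality with weights. -/
theorem mul_rpow_sub_one_le {p a u δ : ℝ} (hp : 1 < p) (ha : 0 ≤ a) (hu : 0 ≤ u) :
    a * u ^ (p - 1) ≤ 1 / p * (a ^ p * Real.exp δ) +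
      (1 - 1 / p) * Real.exp (-(δ / (p - 1))) * u ^ p := by
  have hp0 : 0 < p := by linarith
  have hp1 : 0 < p - 1 := by linarith
  have hpq : p.HolderConjugate (p / (p - 1)) := Real.HolderConjugate.conjExponent hp
  have y := Real.young_inequality_of_nonneg (a := a * Real.exp (δ / p))
    (b := u ^ (p - 1) * Real.exp (-(δ / p))) (by positivity) (by positivity) hpq
  have e0 : a * Real.exp (δ / p) * (u ^ (p - 1) * Real.exp (-(δ / p))) = a * u ^ (p - 1) := by
    have : Real.exp (δ / p) * Real.exp (-(δ / p)) = 1 := by rw [← Real.exp_add]; simp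
    linear_combination a * u ^ (p - 1) * this
  have e1 : (a * Real.exp (δ / p)) ^ p = a ^ p * Real.exp δ := by
    rw [Real.mul_rpow ha (Real.exp_pos _).le, ← Real.exp_mul, div_mul_cancel₀ _ hp0.ne']
  have e2 : (u ^ (p - 1) * Real.exp (-(δ / p))) ^ (p / (p - 1)) =
      u ^ p * Real.exp (-(δ / (p - 1))) := by
    rw [Real.mul_rpow (Real.rpow_nonneg hu _) (Real.exp_pos _).le, ← Real.exp_mul,
      ← Real.rpow_mul hu, mul_div_cancel₀ _ hp1.ne']
    congr 2
    field_simp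
  rw [e0, e1, e2] at y
  refine y.trans (le_of_eq ?_)
  field_simp

namespace SymmetricDiffusion

section Weighted

variable {E : Type*} [NormedAddCommGroup E] [NormedSpace ℝ E] [FiniteDimensional ℝ E]
  {M : Type*} [TopologicalSpace M] [ChartedSpace E M] [IsManifold 𝓘(ℝ, E) ∞ M]
  [T2Space M] [SigmaCompactSpace M] [MeasurableSpace M] [BorelSpace M]
  {μ : Measure M} [IsFiniteMeasureOnCompacts μ] (D : SymmetricDiffusion E μ)

/-- One resolvent step of the weighted inequality. -/
theorem resolvent_weighted_le (h : ℝ≥0) {f : Lp ℝ 2 μ} {p q C : ℝ} (hp : 1 < p)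
    (hq : q = p / (2 * (p - 1))) (hC : 0 ≤ C)
    (hf0 : ∀ᵐ z ∂μ, 0 ≤ f z) (hfC : ∀ᵐ z ∂μ, f z ≤ C) (hfi : Integrable f μ)
    (g : C^∞⟮𝓘(ℝ, E), M; ℝ⟯) {R : ℝ} (hgR : ∀ z, |g z| ≤ R) (hg : ∀ z, D.Γ g g z ≤ 1)
    {τ τ₁ : ℝ} (hτ : 0 < τ) (hτ₁ : τ ≤ τ₁) :
    (1 - stepError p q τ R * (h : ℝ) ^ 2) *
        ∫ z, D.resolvent h f z ^ p * Real.exp (-(g z ^ 2 / (2 * τ₁))) ∂μ ≤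
      ∫ z, f z ^ p * Real.exp (-(g z ^ 2 / (2 * (τ₁ + q * h)))) ∂μ := by
  have hp0 : 0 < p := by linarith
  have hp1 : 0 < p - 1 := by linarith
  have hq0 : 0 < q := by rw [hq]; positivity
  have hh : (0 : ℝ) ≤ h := h.2
  have hτ₁0 : 0 < τ₁ := hτ.trans_le hτ₁
  set u := D.resolvent h f with hu
  have hu0 := D.resolvent_nonneg h hf0
  have huC := D.resolvent_le_of_le h hC hfC
  have hui := D.integrable_resolvent h hf0 hfi
  rw [← hu] at hu0 huC hui
  have hgc : Continuous g := g.contMDiff.continuous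
  set Q : ℝ → ℝ := fun x => -(x ^ 2 / (2 * τ₁)) with hQ
  have hQa : AnalyticOnNhd ℝ Q Set.univ := fun x _ =>
    ((analyticAt_id.pow 2).div_const).neg
  have hQs : ContDiff ℝ ∞ Q := contDiff_iff_contDiffAt.2 fun x => (hQa x trivial).contDiffAt
  have hQd : ∀ x, deriv Q x = -(x / τ₁) := fun x => by
    have := (((hasDerivAt_pow 2 x).div_const (2 * τ₁)).neg).deriv
    rw [hQ]
    refine this.trans ?_
    field_simp
    simp
  set η := postcomp Q hQs g with hη
  have hη0 : ∀ z, η z ≤ 0 := fun z => neg_nonpos.2 (by positivity)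
  have hΓη : ∀ z, D.Γ η η z ≤ g z ^ 2 / τ₁ ^ 2 := fun z => by
    rw [hη, Γ_postcomp_self D _ _ hQa, hQd, neg_sq, div_pow]
    exact mul_le_of_le_one_right (by positivity) (hg z)
  have hgsq : ∀ z, g z ^ 2 ≤ R ^ 2 := fun z => by
    rw [← sq_abs]
    exact pow_le_pow_left₀ (abs_nonneg _) (hgR z) 2
  have hA : ∀ z, D.Γ η η z ≤ R ^ 2 / τ₁ ^ 2 := fun z =>
    (hΓη z).trans (div_le_div_of_nonneg_right (hgsq z) (by positivity))
  obtain ⟨iF, hF⟩ := D.integral_resolvent_rpow_le h hp hC hf0 hfC hfi η hη0 (by positivity) hA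
  rw [← hu] at iF hF
  have iu : Integrable (fun z => u z ^ p * Real.exp (-(g z ^ 2 / (2 * τ₁)))) μ :=
    integrable_rpow_mul_exp hp hui hu0 huC (by fun_prop) hη0
  have if' : Integrable (fun z => f z ^ p * Real.exp (-(g z ^ 2 / (2 * (τ₁ + q * h))))) μ :=
    integrable_rpow_mul_exp hp hfi hf0 hfC (by fun_prop) fun z => neg_nonpos.2 (by positivity)
  have key : ∫ z, 1 / p * ((1 - stepError p q τ R * (h : ℝ) ^ 2) *
        (u z ^ p * Real.exp (-(g z ^ 2 / (2 * τ₁)))) -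
        f z ^ p * Real.exp (-(g z ^ 2 / (2 * (τ₁ + q * h))))) ∂μ ≤ 0 := by
    refine (integral_mono_ae (((iu.const_mul _).sub if').const_mul _) iF ?_).trans hF
    filter_upwards [hu0, hf0] with z h0 h0f
    have e : η z = -(g z ^ 2 / (2 * τ₁)) := rfl
    set δ : ℝ := g z ^ 2 / (2 * τ₁) - g z ^ 2 / (2 * (τ₁ + q * h)) with hδ
    have y1 := mul_rpow_sub_one_le (δ := δ) hp h0f h0
    have y2 := one_sub_stepError_le hp hq hτ hτ₁ hh (sq_nonneg (g z)) (hgsq z) (hΓη z) hδ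
    have hup : 0 ≤ u z ^ p := Real.rpow_nonneg h0 _
    have y3 := mul_le_mul_of_nonneg_right y2 hup
    have e1 : Real.exp (-(g z ^ 2 / (2 * (τ₁ + q * h)))) = Real.exp δ * Real.exp (η z) := by
      rw [← Real.exp_add, e, hδ]
      congr 1
      ring
    rw [Pi.sub_apply, e1, ← e]
    have y4 : 1 / p * ((1 - stepError p q τ R * (h : ℝ) ^ 2) * u z ^ p - f z ^ p * Real.exp δ) ≤
        u z ^ p - h / 4 * D.Γ η η z * (u z ^ p / (p - 1)) - f z * u z ^ (p - 1) := by
      have y5 := mul_le_mul_of_nonneg_left y3 (one_div_pos.2 hp0).le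
      have e2 : 1 / p * (p * (1 - h / 4 * D.Γ η η z / (p - 1) -
          (1 - 1 / p) * Real.exp (-(δ / (p - 1)))) * u z ^ p) =
          u z ^ p - h / 4 * D.Γ η η z * (u z ^ p / (p - 1)) -
          (1 - 1 / p) * Real.exp (-(δ / (p - 1))) * u z ^ p := by
        field_simp
      rw [e2] at y5
      linarith
    have y6 := mul_le_mul_of_nonneg_right y4 (Real.exp_pos (η z)).le
    refine le_trans (le_of_eq ?_) y6
    ring
  rw [integral_const_mul, integral_sub (iu.const_mul _) if', integral_const_mul] at key
  have := nonpos_of_mul_nonpos_right key (one_div_pos.2 hp0)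
  linarith

/-- Iterates of the resolvent preserve bounds and integrability of nonnegative functions. -/
theorem resolvent_pow_bounds (h : ℝ≥0) {f : Lp ℝ 2 μ} {C : ℝ} (hC : 0 ≤ C)
    (hf0 : ∀ᵐ z ∂μ, 0 ≤ f z) (hfC : ∀ᵐ z ∂μ, f z ≤ C) (hfi : Integrable f μ) (j : ℕ) :
    (∀ᵐ z ∂μ, 0 ≤ (D.resolvent h ^ j) f z) ∧ (∀ᵐ z ∂μ, (D.resolvent h ^ j) f z ≤ C) ∧
      Integrable ((D.resolvent h ^ j) f) μ := by
  induction j with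
  | zero => exact ⟨hf0, hfC, hfi⟩
  | succ j ih =>
    obtain ⟨h1, h2, h3⟩ := ih
    have e : (D.resolvent h ^ (j + 1)) f = D.resolvent h ((D.resolvent h ^ j) f) := by
      rw [pow_succ']; rfl
    rw [e]
    exact ⟨D.resolvent_nonneg h h1, D.resolvent_le_of_le h hC h2, D.integrable_resolvent h h1 h3⟩

/-- The steps can be iterated as long as the parameter `T - q s` of the weight stays above `τ`. -/
theorem resolvent_pow_weighted_le (h : ℝ≥0) {f : Lp ℝ 2 μ} {p q C : ℝ} (hp : 1 < p)
    (hq : q = p / (2 * (p - 1))) (hC : 0 ≤ C)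
    (hf0 : ∀ᵐ z ∂μ, 0 ≤ f z) (hfC : ∀ᵐ z ∂μ, f z ≤ C) (hfi : Integrable f μ)
    (g : C^∞⟮𝓘(ℝ, E), M; ℝ⟯) {R : ℝ} (hgR : ∀ z, |g z| ≤ R) (hg : ∀ z, D.Γ g g z ≤ 1)
    {τ T : ℝ} (hτ : 0 < τ) (hK : 0 ≤ 1 - stepError p q τ R * (h : ℝ) ^ 2) (j : ℕ)
    (hj : τ ≤ T - q * (h * j)) :
    (1 - stepError p q τ R * (h : ℝ) ^ 2) ^ j *
        ∫ z, (D.resolvent h ^ j) f z ^ p * Real.exp (-(g z ^ 2 / (2 * (T - q * (h * j))))) ∂μ ≤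
      ∫ z, f z ^ p * Real.exp (-(g z ^ 2 / (2 * T))) ∂μ := by
  have hp1 : 0 < p - 1 := by linarith
  have hq0 : 0 < q := by rw [hq]; positivity
  have hh : (0 : ℝ) ≤ h := h.2
  induction j with
  | zero => simp
  | succ j ih =>
    have hqh : 0 ≤ q * h := by positivity
    have hj' : τ ≤ T - q * (h * j) := by
      push_cast at hj
      linarith
    refine le_trans ?_ (ih hj')
    obtain ⟨h1, h2, h3⟩ := D.resolvent_pow_bounds h hC hf0 hfC hfi j
    have e : (D.resolvent h ^ (j + 1)) f = D.resolvent h ((D.resolvent h ^ j) f) := by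
      rw [pow_succ' (D.resolvent h)]; rfl
    have step := D.resolvent_weighted_le h hp hq hC h1 h2 h3 g hgR hg hτ hj
    rw [show T - q * (h * ((j + 1 : ℕ) : ℝ)) + q * h = T - q * (h * j) by push_cast; ring] at step
    rw [e, pow_succ, mul_assoc]
    exact mul_le_mul_of_nonneg_left step (pow_nonneg hK j)

/-- Almost everywhere convergence of the exponential formula along a subsequence. -/
theorem exists_subseq_tendsto_semigroupL2 (t : ℝ≥0) (f : Lp ℝ 2 μ) :
    ∃ ns : ℕ → ℕ, StrictMono ns ∧ ∀ᵐ z ∂μ,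
      Tendsto (fun n => ((D.resolvent (t / 2 ^ ns n)) ^ (2 ^ ns n)) f z) atTop
        (𝓝 (D.semigroupL2 t f z)) :=
  exists_subseq_tendsto_ae_of_tendsto_Lp
    (v := fun k : ℕ => ((D.resolvent (t / 2 ^ k)) ^ (2 ^ k)) f) (D.tendsto_semigroupL2 t f)

theorem semigroupL2_nonneg (t : ℝ≥0) {f : Lp ℝ 2 μ} (hf : ∀ᵐ z ∂μ, 0 ≤ f z) :
    ∀ᵐ z ∂μ, 0 ≤ D.semigroupL2 t f z := by
  have hpow : ∀ (h : ℝ≥0) (j : ℕ), ∀ᵐ z ∂μ, 0 ≤ (D.resolvent h ^ j) f z := by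
    intro h j
    induction j with
    | zero => exact hf
    | succ j ih => rw [pow_succ']; exact D.resolvent_nonneg h ih
  obtain ⟨ns, -, hae⟩ := D.exists_subseq_tendsto_semigroupL2 t f
  have hall : ∀ᵐ z ∂μ, ∀ n, 0 ≤ ((D.resolvent (t / 2 ^ ns n)) ^ (2 ^ ns n)) f z :=
    ae_all_iff.2 fun n => hpow _ _
  filter_upwards [hae, hall] with z h1 h2 using ge_of_tendsto' h1 h2

theorem semigroupL2_sub (t : ℝ≥0) (f g : Lp ℝ 2 μ) :
    D.semigroupL2 t (f - g) = D.semigroupL2 t f - D.semigroupL2 t g := by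
  refine tendsto_nhds_unique (D.tendsto_semigroupL2 t (f - g)) ?_
  simp only [map_sub]
  exact (D.tendsto_semigroupL2 t f).sub (D.tendsto_semigroupL2 t g)

theorem semigroupL2_mono (t : ℝ≥0) {f g : Lp ℝ 2 μ} (hfg : ∀ᵐ z ∂μ, f z ≤ g z) :
    ∀ᵐ z ∂μ, D.semigroupL2 t f z ≤ D.semigroupL2 t g z := by
  have h1 : ∀ᵐ z ∂μ, 0 ≤ (g - f) z := by
    filter_upwards [hfg, Lp.coeFn_sub g f] with z h1 h2
    rw [h2]
    exact sub_nonneg.2 h1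
  have h2 := D.semigroupL2_nonneg t h1
  rw [semigroupL2_sub] at h2
  filter_upwards [h2, Lp.coeFn_sub (D.semigroupL2 t g) (D.semigroupL2 t f)] with z h3 h4
  rw [h4] at h3
  exact sub_nonneg.1 h3

/-- The weighted inequality for the semigroup, with a bounded smooth function `g` such that
`Γ(g) ≤ 1` in place of the distance. The errors of the `N = 2 ^ k` resolvent steps of size `t / N`
add up to `O(1 / N)`. -/
theorem semigroupL2_weighted_le (t : ℝ≥0) {f : Lp ℝ 2 μ} {p q C T : ℝ} (hp : 1 < p)
    (hq : q = p / (2 * (p - 1))) (hC : 0 ≤ C)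
    (hf0 : ∀ᵐ z ∂μ, 0 ≤ f z) (hfC : ∀ᵐ z ∂μ, f z ≤ C) (hfi : Integrable f μ)
    (g : C^∞⟮𝓘(ℝ, E), M; ℝ⟯) {R : ℝ} (hgR : ∀ z, |g z| ≤ R) (hg : ∀ z, D.Γ g g z ≤ 1)
    (hT : 0 < T - q * t) :
    ∫⁻ z, ENNReal.ofReal (D.semigroupL2 t f z ^ p *
        Real.exp (-(g z ^ 2 / (2 * (T - q * t))))) ∂μ ≤
      ENNReal.ofReal (∫ z, f z ^ p * Real.exp (-(g z ^ 2 / (2 * T))) ∂μ) := by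
  have hgc : Continuous g := g.contMDiff.continuous
  set K := stepError p q (T - q * t) R with hK
  have hK0 : 0 ≤ K := stepError_nonneg hp hT
  set I := ∫ z, f z ^ p * Real.exp (-(g z ^ 2 / (2 * T))) ∂μ with hI
  obtain ⟨ns, hns, hae⟩ := D.exists_subseq_tendsto_semigroupL2 t f
  have hN : Tendsto (fun n => ((2 : ℝ) ^ ns n)⁻¹) atTop (𝓝 0) :=
    ((tendsto_pow_atTop_atTop_of_one_lt one_lt_two).comp hns.tendsto_atTop).inv_tendsto_atTop
  have hden : Tendsto (fun n => 1 - K * (t : ℝ) ^ 2 * ((2 : ℝ) ^ ns n)⁻¹) atTop (𝓝 1) := by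
    have := (hN.const_mul (K * (t : ℝ) ^ 2)).const_sub 1
    rwa [mul_zero, sub_zero] at this
  have hb := fun n => D.resolvent_pow_bounds (t / 2 ^ ns n) hC hf0 hfC hfi (2 ^ ns n)
  refine lintegral_ofReal_le_of_tendsto_ae
    (Z := fun n z => ((D.resolvent (t / 2 ^ ns n)) ^ (2 ^ ns n)) f z ^ p *
      Real.exp (-(g z ^ 2 / (2 * (T - q * t)))))
    (e := fun n => I / (1 - K * (t : ℝ) ^ 2 * ((2 : ℝ) ^ ns n)⁻¹)) (fun n => ?_) (fun n => ?_) ?_ ?_ ?_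
  · exact integrable_rpow_mul_exp hp (hb n).2.2 (hb n).1 (hb n).2.1 (by fun_prop)
      fun z => neg_nonpos.2 (by positivity)
  · filter_upwards [(hb n).1] with z hz
    exact mul_nonneg (Real.rpow_nonneg hz _) (Real.exp_pos _).le
  · filter_upwards [hae] with z hz
    exact (((Real.continuous_rpow_const (by linarith)).tendsto _).comp hz).mul_const _
  · filter_upwards [hden.eventually (lt_mem_nhds (zero_lt_one (α := ℝ)))] with n hn
    set N : ℝ := (2 : ℝ) ^ ns n with hNdef
    have hN1 : 1 ≤ N := one_le_pow₀ one_le_two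
    have hN0 : 0 < N := by positivity
    have eh : ((t / 2 ^ ns n : ℝ≥0) : ℝ) = t / N := by push_cast; rfl
    have eN : ((2 ^ ns n : ℕ) : ℝ) = N := by push_cast; rfl
    have hx : K * ((t / 2 ^ ns n : ℝ≥0) : ℝ) ^ 2 = K * (t : ℝ) ^ 2 * N⁻¹ * N⁻¹ := by
      rw [eh]; field_simp
    have hx0 : 0 ≤ K * (t : ℝ) ^ 2 * N⁻¹ := by positivity
    have hx1 : K * (t : ℝ) ^ 2 * N⁻¹ * N⁻¹ ≤ K * (t : ℝ) ^ 2 * N⁻¹ :=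
      mul_le_of_le_one_right hx0 (inv_le_one_of_one_le₀ hN1)
    have hpos : 0 ≤ 1 - K * ((t / 2 ^ ns n : ℝ≥0) : ℝ) ^ 2 := by rw [hx]; linarith
    have etau : T - q * (((t / 2 ^ ns n : ℝ≥0) : ℝ) * ((2 ^ ns n : ℕ) : ℝ)) = T - q * t := by
      rw [eh, eN, div_mul_cancel₀ _ hN0.ne']
    have it := D.resolvent_pow_weighted_le (t / 2 ^ ns n) hp hq hC hf0 hfC hfi g hgR hg hT hpos
      (2 ^ ns n) etau.ge
    rw [etau] at it
    -- Bernoulli's inequality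
    have bern : 1 - K * (t : ℝ) ^ 2 * N⁻¹ ≤
        (1 - K * ((t / 2 ^ ns n : ℝ≥0) : ℝ) ^ 2) ^ (2 ^ ns n) := by
      have := one_add_mul_le_pow (a := -(K * ((t / 2 ^ ns n : ℝ≥0) : ℝ) ^ 2)) (by linarith) (2 ^ ns n)
      rw [eN, ← sub_eq_add_neg] at this
      refine le_trans (le_of_eq ?_) this
      rw [hx]
      field_simp
      ring
    rw [le_div_iff₀ hn, mul_comm]
    refine le_trans (mul_le_mul_of_nonneg_right bern (integral_nonneg_of_ae ?_)) it
    filter_upwards [(hb n).1] with z hz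
    exact mul_nonneg (Real.rpow_nonneg hz _) (Real.exp_pos _).le
  · have := (tendsto_const_nhds (x := I)).div hden one_ne_zero
    rwa [div_one] at this

end Weighted

end SymmetricDiffusion

/-! ### Smooth approximation of the canonical distance -/

/-- The truncation `x / (1 + ε x²)`: a bounded function with derivative in `[-1, 1]`. -/
noncomputable def truncation (ε x : ℝ) : ℝ := x / (1 + ε * x ^ 2)

section Truncation

variable {ε : ℝ}

theorem analyticOnNhd_truncation (hε : 0 < ε) : AnalyticOnNhd ℝ (truncation ε) Set.univ :=
  fun x _ => analyticAt_id.div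
    (analyticAt_const.add (analyticAt_const.mul (analyticAt_id.pow 2))) (by positivity)

theorem deriv_truncation_sq_le (hε : 0 < ε) (x : ℝ) : deriv (truncation ε) x ^ 2 ≤ 1 := by
  have h1 : 0 < 1 + ε * x ^ 2 := by positivity
  have d1 : HasDerivAt (fun y : ℝ => y ^ 2) (2 * x) x := by simpa using hasDerivAt_pow 2 x
  have d2 : HasDerivAt (truncation ε) _ x :=
    (hasDerivAt_id x).div ((d1.const_mul ε).const_add 1) h1.ne'
  rw [d2.deriv, id, div_pow]
  refine div_le_one_of_le₀ (sq_le_sq' ?_ ?_) (by positivity)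
  · nlinarith [mul_nonneg hε.le (sq_nonneg x),
      mul_nonneg (mul_nonneg hε.le hε.le) (sq_nonneg (x ^ 2))]
  · nlinarith [mul_nonneg hε.le (sq_nonneg x),
      mul_nonneg (mul_nonneg hε.le hε.le) (sq_nonneg (x ^ 2))]

theorem abs_truncation_le (hε : 0 < ε) (hε1 : ε ≤ 1) (x : ℝ) : |truncation ε x| ≤ ε⁻¹ := by
  have h1 : 0 < 1 + ε * x ^ 2 := by positivity
  rw [truncation, abs_div, abs_of_pos h1, div_le_iff₀ h1, inv_mul_eq_div, le_div_iff₀ hε, ← sq_abs x]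
  nlinarith [mul_nonneg hε.le (sq_nonneg (|x| - 1)), abs_nonneg x]

theorem tendsto_truncation (x : ℝ) : Tendsto (fun ε => truncation ε x) (𝓝 0) (𝓝 x) := by
  have h : ContinuousAt (fun ε : ℝ => truncation ε x) 0 := by
    unfold truncation
    exact ContinuousAt.div (by fun_prop) (by fun_prop) (by simp)
  have e : truncation 0 x = x := by simp [truncation]
  have := h.tendsto
  rwa [e] at this

end Truncation

namespace SymmetricDiffusion

section Distance

variable {E : Type*} [NormedAddCommGroup E] [NormedSpace ℝ E] [FiniteDimensional ℝ E]
  {M : Type*} [TopologicalSpace M] [ChartedSpace E M] [IsManifold 𝓘(ℝ, E) ∞ M]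
  [T2Space M] [SigmaCompactSpace M] [MeasurableSpace M] [BorelSpace M]
  {μ : Measure M} (D : SymmetricDiffusion E μ)

/-- The bounded smooth functions `g` with `Γ(g) ≤ 1` that vanish at `x`. -/
def boundedAdmissible (x : M) : Set C^∞⟮𝓘(ℝ, E), M; ℝ⟯ :=
  {g | g x = 0 ∧ (∃ R, ∀ z, |g z| ≤ R) ∧ ∀ z, D.Γ g g z ≤ 1}

theorem zero_mem_boundedAdmissible (x : M) : 0 ∈ D.boundedAdmissible x :=
  ⟨rfl, ⟨0, fun z => by change |(0 : ℝ)| ≤ 0; simp⟩, fun z => by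
    rw [Γ_zero_left]; exact zero_le_one⟩

theorem ofReal_abs_le_dist {x : M} {g : C^∞⟮𝓘(ℝ, E), M; ℝ⟯} (hg : g ∈ D.boundedAdmissible x)
    (y : M) : ENNReal.ofReal |g y| ≤ D.dist x y := by
  refine le_iSup₂_of_le g hg.2.2 ?_
  rw [hg.1, zero_sub, abs_neg]

theorem exists_boundedAdmissible_gt {x y : M} {r : ℝ≥0∞} (hr : r < D.dist x y) :
    ∃ g ∈ D.boundedAdmissible x, r < ENNReal.ofReal |g y| := by
  obtain ⟨f, hf⟩ := lt_iSup_iff.1 hr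
  obtain ⟨hΓ, hf⟩ := lt_iSup_iff.1 hf
  set f₀ := f + (-f x) • (1 : C^∞⟮𝓘(ℝ, E), M; ℝ⟯) with hf₀
  have e₀ : ∀ z, f₀ z = f z - f x := fun z => by
    change f z + -f x * 1 = f z - f x
    ring
  have hΓ₀ : ∀ z, D.Γ f₀ f₀ z ≤ 1 := fun z => by
    rw [hf₀, Γ_quadratic, Γ_one_left, D.Γ_comm f 1, Γ_one_left]
    change D.Γ f f z + 2 * -f x * 0 + (-f x) ^ 2 * 0 ≤ 1
    linarith [hΓ z]
  have hs : ∀ ε : ℝ, 0 < ε → ContDiff ℝ ∞ (truncation ε) := fun ε hε =>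
    contDiff_iff_contDiffAt.2 fun x => (analyticOnNhd_truncation hε x trivial).contDiffAt
  have hlim : Tendsto (fun ε => ENNReal.ofReal |truncation ε (f₀ y)|) (𝓝[>] 0)
      (𝓝 (ENNReal.ofReal |f₀ y|)) :=
    (ENNReal.continuous_ofReal.tendsto _).comp
      ((tendsto_truncation (f₀ y)).mono_left nhdsWithin_le_nhds).abs
  rw [abs_sub_comm, ← e₀] at hf
  obtain ⟨ε, hε, hε0, hε1⟩ := ((hlim.eventually (lt_mem_nhds hf)).and
    (Ioc_mem_nhdsGT (zero_lt_one (α := ℝ)))).exists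
  refine ⟨postcomp (truncation ε) (hs ε hε0) f₀, ⟨?_, ⟨ε⁻¹, fun z => ?_⟩, fun z => ?_⟩, hε⟩
  · change truncation ε (f₀ x) = 0
    rw [e₀, sub_self, truncation, zero_div]
  · exact abs_truncation_le hε0 hε1 _
  · rw [Γ_postcomp_self D _ _ (analyticOnNhd_truncation hε0)]
    exact mul_le_one₀ (deriv_truncation_sq_le hε0 _) (D.Γ_self_nonneg _ z) (hΓ₀ z)

/-- By the Lindelöf property, countably many admissible functions determine the distance to `x`. -/
theorem exists_seq_boundedAdmissible (x : M) : ∃ G : ℕ → C^∞⟮𝓘(ℝ, E), M; ℝ⟯,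
    (∀ i, G i ∈ D.boundedAdmissible x) ∧
      ∀ y, ∀ r < D.dist x y, ∃ i, r < ENNReal.ofReal |G i y| := by
  have : SecondCountableTopology M := ChartedSpace.secondCountable_of_sigmaCompact E M
  have hopen : ∀ (a : ℚ) (g : C^∞⟮𝓘(ℝ, E), M; ℝ⟯),
      IsOpen {y | ENNReal.ofReal a < ENNReal.ofReal |g y|} := fun a g =>
    isOpen_lt continuous_const (ENNReal.continuous_ofReal.comp g.contMDiff.continuous.abs)
  choose T hTB hTc hT using fun a : ℚ => TopologicalSpace.isOpen_biUnion_countable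
    (D.boundedAdmissible x) (fun g => {y | ENNReal.ofReal a < ENNReal.ofReal |g y|})
    (fun g _ => hopen a g)
  have hc : (insert 0 (⋃ a, T a)).Countable := (Set.countable_iUnion hTc).insert 0
  obtain ⟨G, hG⟩ := hc.exists_eq_range (Set.insert_nonempty _ _)
  refine ⟨G, fun i => ?_, fun y r hr => ?_⟩
  · have : G i ∈ insert 0 (⋃ a, T a) := by rw [hG]; exact Set.mem_range_self i
    rcases this with h | h
    · rw [h]; exact D.zero_mem_boundedAdmissible x
    · obtain ⟨a, ha⟩ := Set.mem_iUnion.1 h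
      exact hTB a ha
  · obtain ⟨a, ha0, hra, had⟩ := ENNReal.lt_iff_exists_rat_btwn.1 hr
    obtain ⟨g, hg, hgy⟩ := D.exists_boundedAdmissible_gt had
    have hmem : y ∈ ⋃ g ∈ D.boundedAdmissible x, {y | ENNReal.ofReal a < ENNReal.ofReal |g y|} :=
      Set.mem_biUnion hg hgy
    rw [← hT a] at hmem
    obtain ⟨k, hk, hky⟩ := Set.mem_iUnion₂.1 hmem
    have hk2 : k ∈ Set.range G := by
      rw [← hG]; exact Or.inr (Set.mem_iUnion.2 ⟨a, hk⟩)
    obtain ⟨i, rfl⟩ := hk2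
    exact ⟨i, hra.trans hky⟩

/-- The sum `∑ i ≤ n, (e^{c G i} + e^{-c G i})` and its properties. -/
theorem exists_sum_exp {G : ℕ → C^∞⟮𝓘(ℝ, E), M; ℝ⟯} (hG : ∀ i z, D.Γ (G i) (G i) z ≤ 1)
    {c : ℝ} (hc : 0 < c) (n : ℕ) : ∃ S : C^∞⟮𝓘(ℝ, E), M; ℝ⟯,
    (∀ z, D.Γ S S z ≤ (c * S z) ^ 2) ∧ (∀ z, ∀ i ≤ n, Real.exp (c * |G i z|) ≤ S z) ∧
      ∀ z b, (∀ i ≤ n, |G i z| ≤ b) → S z ≤ 2 * (n + 1) * Real.exp (c * b) := by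
  have hexp : ∀ (i : ℕ) (a : ℝ), a ^ 2 = c ^ 2 → ∀ z,
      D.Γ (expWeight (a • G i)) (expWeight (a • G i)) z ≤ (c * expWeight (a • G i) z) ^ 2 := by
    intro i a ha z
    rw [expWeight, Γ_postcomp_self D _ _ analyticOnNhd_exp, Real.deriv_exp, Γ_smul_left,
      Γ_smul_right]
    change Real.exp (a * G i z) ^ 2 * (a * (a * D.Γ (G i) (G i) z)) ≤
      (c * Real.exp (a * G i z)) ^ 2
    have := mul_le_mul_of_nonneg_left (hG i z)
      (mul_nonneg (sq_nonneg (Real.exp (a * G i z))) (sq_nonneg a))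
    rw [mul_pow, ← ha]
    linarith
  have hpos : ∀ (k : C^∞⟮𝓘(ℝ, E), M; ℝ⟯) z, 0 < expWeight k z := fun k z => Real.exp_pos _
  set F : ℕ → C^∞⟮𝓘(ℝ, E), M; ℝ⟯ := fun i => expWeight (c • G i) + expWeight ((-c) • G i) with hF
  have hF0 : ∀ i z, F i z = Real.exp (c * G i z) + Real.exp (-c * G i z) := fun i z => rfl
  have hF1 : ∀ i z, D.Γ (F i) (F i) z ≤ (c * F i z) ^ 2 := fun i z => by
    have := D.Γ_add_self_le _ _ z (mul_pos hc (hpos _ z)).le (mul_pos hc (hpos _ z)).le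
      (hexp i c rfl z) (hexp i (-c) (neg_sq c) z)
    rwa [← mul_add] at this
  have hF2 : ∀ i z, Real.exp (c * |G i z|) ≤ F i z := fun i z => by
    rw [hF0]
    have p1 := Real.exp_pos (c * G i z)
    have p2 := Real.exp_pos (-c * G i z)
    rcases abs_cases (G i z) with ⟨h, -⟩ | ⟨h, -⟩
    · rw [h]; linarith
    · rw [h, mul_neg, ← neg_mul]; linarith
  have hF3 : ∀ i z b, |G i z| ≤ b → F i z ≤ 2 * Real.exp (c * b) := fun i z b hb => by
    rw [hF0]
    have h1 : Real.exp (c * G i z) ≤ Real.exp (c * b) :=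
      Real.exp_le_exp.2 (mul_le_mul_of_nonneg_left ((le_abs_self _).trans hb) hc.le)
    have h2 : Real.exp (-c * G i z) ≤ Real.exp (c * b) := by
      rw [neg_mul, ← mul_neg]
      exact Real.exp_le_exp.2 (mul_le_mul_of_nonneg_left ((neg_le_abs _).trans hb) hc.le)
    linarith
  induction n with
  | zero =>
    refine ⟨F 0, hF1 0, fun z i hi => ?_, fun z b hb => ?_⟩
    · rw [Nat.le_zero.1 hi]; exact hF2 0 z
    · have := hF3 0 z b (hb 0 le_rfl)
      simpa using this
  | succ n ih =>
    obtain ⟨S, h1, h2, h3⟩ := ih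
    have hSpos : ∀ z, 0 < S z := fun z => (Real.exp_pos _).trans_le (h2 z 0 (Nat.zero_le n))
    have hFpos : ∀ i z, 0 < F i z := fun i z => (Real.exp_pos _).trans_le (hF2 i z)
    refine ⟨S + F (n + 1), fun z => ?_, fun z i hi => ?_, fun z b hb => ?_⟩
    · have := D.Γ_add_self_le _ _ z (mul_pos hc (hSpos z)).le (mul_pos hc (hFpos _ z)).le
        (h1 z) (hF1 (n + 1) z)
      rwa [← mul_add] at this
    · change _ ≤ S z + F (n + 1) z
      rcases Nat.le_succ_iff.1 hi with hi | rfl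
      · linarith [h2 z i hi, hFpos (n + 1) z]
      · linarith [hF2 (n + 1) z, hSpos z]
    · change S z + F (n + 1) z ≤ _
      have k1 := h3 z b fun i hi => hb i (hi.trans n.le_succ)
      have k2 := hF3 (n + 1) z b (hb (n + 1) le_rfl)
      push_cast
      linarith

/-- A smooth substitute for the maximum of `|G i|`, `i ≤ n`: the log-sum-exp
`c⁻¹ log ∑ i ≤ n, (e^{c G i} + e^{-c G i})`, whose gradient is a convex combination of the gradients
of the functions `± G i`. -/
theorem exists_smooth_max {G : ℕ → C^∞⟮𝓘(ℝ, E), M; ℝ⟯} (hG : ∀ i z, D.Γ (G i) (G i) z ≤ 1)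
    {c : ℝ} (hc : 0 < c) (n : ℕ) : ∃ g : C^∞⟮𝓘(ℝ, E), M; ℝ⟯,
    (∀ z, D.Γ g g z ≤ 1) ∧ (∀ z, ∀ i ≤ n, |G i z| ≤ g z) ∧
      ∀ z b, (∀ i ≤ n, |G i z| ≤ b) → g z ≤ b + 2 * (n + 1) / c := by
  obtain ⟨S, h1, h2, h3⟩ := D.exists_sum_exp hG hc n
  have hSpos : ∀ z, 0 < S z := fun z => (Real.exp_pos _).trans_le (h2 z 0 (Nat.zero_le n))
  set l : C^∞⟮𝓘(ℝ, E), M; ℝ⟯ := ⟨fun z => Real.log (S z), fun z =>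
    ((Real.contDiffAt_log.2 (hSpos z).ne').contMDiffAt).comp z (S.contMDiff z)⟩ with hl
  have hl0 : ∀ z, l z = Real.log (S z) := fun z => rfl
  have hlS : expWeight l = S := by
    ext z
    exact Real.exp_log (hSpos z)
  have hΓl : ∀ z, D.Γ l l z ≤ c ^ 2 := fun z => by
    have e := D.Γ_postcomp_self l z analyticOnNhd_exp Real.contDiff_exp
    rw [Real.deriv_exp, hl0, Real.exp_log (hSpos z)] at e
    change D.Γ (expWeight l) (expWeight l) z = _ at e
    rw [hlS] at e
    have := h1 z
    rw [e, mul_pow, mul_comm (c ^ 2)] at this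
    exact le_of_mul_le_mul_left this (pow_pos (hSpos z) 2)
  refine ⟨c⁻¹ • l, fun z => ?_, fun z i hi => ?_, fun z b hb => ?_⟩
  · rw [Γ_smul_left, Γ_smul_right]
    change c⁻¹ * (c⁻¹ * D.Γ l l z) ≤ 1
    rw [← mul_assoc, ← sq, inv_pow, inv_mul_le_iff₀ (by positivity), mul_one]
    exact hΓl z
  · change _ ≤ c⁻¹ * Real.log (S z)
    rw [le_inv_mul_iff₀ hc, Real.le_log_iff_exp_le (hSpos z)]
    exact h2 z i hi
  · change c⁻¹ * Real.log (S z) ≤ _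
    have hn : (0 : ℝ) < 2 * (n + 1) := by positivity
    have k1 := Real.log_le_log (hSpos z) (h3 z b hb)
    rw [Real.log_mul hn.ne' (Real.exp_pos _).ne', Real.log_exp] at k1
    have k2 := Real.log_le_self hn.le
    rw [inv_mul_le_iff₀ hc, mul_add, mul_div_cancel₀ _ hc.ne']
    linarith

/-- The distance to `x` is a pointwise limit of bounded smooth functions with `Γ ≤ 1`. -/
theorem exists_seq_tendsto_dist (x : M) : ∃ g : ℕ → C^∞⟮𝓘(ℝ, E), M; ℝ⟯,
    (∀ n, ∃ R, ∀ z, |g n z| ≤ R) ∧ (∀ n z, D.Γ (g n) (g n) z ≤ 1) ∧ (∀ n z, 0 ≤ g n z) ∧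
      ∀ y, Tendsto (fun n => ENNReal.ofReal (g n y)) atTop (𝓝 (D.dist x y)) := by
  obtain ⟨G, hG, hGd⟩ := D.exists_seq_boundedAdmissible x
  have hc : ∀ n : ℕ, (0 : ℝ) < (n + 1 : ℝ) ^ 2 := fun n => by positivity
  choose g hg1 hg2 hg3 using fun n : ℕ =>
    D.exists_smooth_max (fun i z => (hG i).2.2 z) (hc n) n
  have hg0 : ∀ n z, 0 ≤ g n z := fun n z => (abs_nonneg _).trans (hg2 n z 0 (Nat.zero_le n))
  have he : ∀ n : ℕ, 2 * ((n : ℝ) + 1) / ((n : ℝ) + 1) ^ 2 = 2 * (1 / ((n : ℝ) + 1)) := fun n => by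
    have : (0 : ℝ) < n + 1 := by positivity
    field_simp
  refine ⟨g, fun n => ?_, hg1, hg0, fun y => ?_⟩
  · choose R hR using fun i => (hG i).2.1
    have hR0 : ∀ i, 0 ≤ R i := fun i => (abs_nonneg _).trans (hR i x)
    refine ⟨∑ i ∈ Finset.range (n + 1), R i + 2 * (n + 1) / ((n : ℝ) + 1) ^ 2, fun z => ?_⟩
    rw [abs_of_nonneg (hg0 n z)]
    refine hg3 n z _ fun i hi => (hR i z).trans ?_
    exact Finset.single_le_sum (f := R) (fun j _ => hR0 j) (Finset.mem_range.2 (Nat.lt_succ_of_le hi))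
  · refine tendsto_order.2 ⟨fun r hr => ?_, fun r hr => ?_⟩
    · obtain ⟨i, hi⟩ := hGd y r hr
      filter_upwards [eventually_ge_atTop i] with n hn
      exact hi.trans_le (ENNReal.ofReal_le_ofReal (hg2 n y i hn))
    · have hfin : D.dist x y ≠ ⊤ := (hr.trans_le le_top).ne
      have hlim : Tendsto (fun n : ℕ => ENNReal.ofReal ((D.dist x y).toReal + 2 * (1 / ((n : ℝ) + 1))))
          atTop (𝓝 (D.dist x y)) := by
        have := (tendsto_one_div_add_atTop_nhds_zero_nat (𝕜 := ℝ)).const_mul 2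
        have h2 := this.const_add (D.dist x y).toReal
        rw [mul_zero, add_zero] at h2
        have h3 := (ENNReal.continuous_ofReal.tendsto _).comp h2
        rwa [ENNReal.ofReal_toReal hfin] at h3
      filter_upwards [hlim.eventually (gt_mem_nhds hr)] with n hn
      refine lt_of_le_of_lt (ENNReal.ofReal_le_ofReal ?_) hn
      rw [← he]
      refine hg3 n y _ fun i _ => ?_
      exact (ENNReal.ofReal_le_iff_le_toReal hfin).1 (D.ofReal_abs_le_dist (hG i) y)

theorem measurable_dist (x : M) : Measurable (D.dist x) := by
  refine LowerSemicontinuous.measurable ?_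
  refine lowerSemicontinuous_iSup fun f => lowerSemicontinuous_iSup fun _ => ?_
  have : Continuous fun y => ENNReal.ofReal |f x - f y| :=
    ENNReal.continuous_ofReal.comp (continuous_const.sub f.contMDiff.continuous).abs
  exact this.lowerSemicontinuous

end Distance

end SymmetricDiffusion

/-! ### Passage to the limit in the weight and in the initial datum -/

/-- The Gaussian weight `e^{-d² / c}` for `d, c ∈ [0, ∞]`. -/
noncomputable def gaussWeight (c d : ℝ≥0∞) : ℝ≥0∞ := EReal.exp (-((d ^ 2 / c : ℝ≥0∞) : EReal))

theorem continuous_gaussWeight {c : ℝ≥0∞} (hc : c ≠ 0) : Continuous (gaussWeight c) := by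
  refine ENNReal.continuous_exp.comp (continuous_neg.comp (continuous_coe_ennreal_ereal.comp ?_))
  exact (ENNReal.continuous_div_const c hc).comp (ENNReal.continuous_pow 2)

theorem gaussWeight_ofReal {a c : ℝ} (ha : 0 ≤ a) (hc : 0 < c) :
    gaussWeight (ENNReal.ofReal c) (ENNReal.ofReal a) =
      ENNReal.ofReal (Real.exp (-(a ^ 2 / c))) := by
  rw [gaussWeight, ← ENNReal.ofReal_pow ha, ← ENNReal.ofReal_div_of_pos hc,
    EReal.coe_ennreal_ofReal, max_eq_left (by positivity), ← EReal.coe_neg, EReal.exp_coe]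

theorem gaussWeight_le_one (c d : ℝ≥0∞) : gaussWeight c d ≤ 1 := by
  rw [gaussWeight, EReal.exp_le_one_iff, EReal.neg_le, neg_zero]
  exact EReal.coe_ennreal_nonneg _

namespace SymmetricDiffusion

section Limit

variable {E : Type*} [NormedAddCommGroup E] [NormedSpace ℝ E] [FiniteDimensional ℝ E]
  {M : Type*} [TopologicalSpace M] [ChartedSpace E M] [IsManifold 𝓘(ℝ, E) ∞ M]
  [T2Space M] [SigmaCompactSpace M] [MeasurableSpace M] [BorelSpace M]
  {μ : Measure M} [IsFiniteMeasureOnCompacts μ] (D : SymmetricDiffusion E μ)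

/-- The weighted inequality for bounded integrable initial data in `L²`. -/
theorem lintegral_semigroupL2_le (x : M) (t : ℝ≥0) {f : Lp ℝ 2 μ} {p q C T : ℝ} (hp : 1 < p)
    (hq : q = p / (2 * (p - 1))) (hC : 0 ≤ C)
    (hf0 : ∀ᵐ z ∂μ, 0 ≤ f z) (hfC : ∀ᵐ z ∂μ, f z ≤ C) (hfi : Integrable f μ)
    (hT0 : 0 < T) (hT : 0 < T - q * t) :
    ∫⁻ y, ENNReal.ofReal (D.semigroupL2 t f y) ^ p *
        gaussWeight (ENNReal.ofReal (2 * (T - q * t))) (D.dist x y) ∂μ ≤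
      ∫⁻ y, ENNReal.ofReal (f y) ^ p * gaussWeight (ENNReal.ofReal (2 * T)) (D.dist x y) ∂μ := by
  have hp0 : 0 < p := by linarith
  obtain ⟨g, hgR, hgΓ, hg0, hgd⟩ := D.exists_seq_tendsto_dist x
  have conv : ∀ {c : ℝ}, 0 < c → ∀ y, Tendsto
      (fun n => gaussWeight (ENNReal.ofReal c) (ENNReal.ofReal (g n y))) atTop
      (𝓝 (gaussWeight (ENNReal.ofReal c) (D.dist x y))) := fun hc y =>
    ((continuous_gaussWeight (ENNReal.ofReal_pos.2 hc).ne').tendsto _).comp (hgd y)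
  have hmeas : ∀ (v : Lp ℝ 2 μ) (c : ℝ), 0 < c → ∀ n, AEMeasurable (fun y =>
      ENNReal.ofReal (v y) ^ p * gaussWeight (ENNReal.ofReal c) (ENNReal.ofReal (g n y))) μ := by
    intro v c hc n
    refine ((Lp.aestronglyMeasurable v).aemeasurable.ennreal_ofReal.pow_const p).mul ?_
    exact ((continuous_gaussWeight (ENNReal.ofReal_pos.2 hc).ne').comp
      (ENNReal.continuous_ofReal.comp (g n).contMDiff.continuous)).measurable.aemeasurable
  have hlim : ∀ (v : Lp ℝ 2 μ) {c : ℝ}, 0 < c → ∀ y, Tendsto (fun n => ENNReal.ofReal (v y) ^ p *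
      gaussWeight (ENNReal.ofReal c) (ENNReal.ofReal (g n y))) atTop
      (𝓝 (ENNReal.ofReal (v y) ^ p * gaussWeight (ENNReal.ofReal c) (D.dist x y))) :=
    fun v c hc y => ENNReal.Tendsto.const_mul (conv hc y)
      (Or.inr (ENNReal.rpow_ne_top_of_nonneg hp0.le ENNReal.ofReal_ne_top))
  have hreal : ∀ {a b c : ℝ}, 0 ≤ a → 0 ≤ b → 0 < c →
      ENNReal.ofReal a ^ p * gaussWeight (ENNReal.ofReal c) (ENNReal.ofReal b) =
        ENNReal.ofReal (a ^ p * Real.exp (-(b ^ 2 / c))) := fun ha hb hc => by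
    rw [gaussWeight_ofReal hb hc, ENNReal.ofReal_rpow_of_nonneg ha hp0.le,
      ← ENNReal.ofReal_mul (Real.rpow_nonneg ha _)]
  have hP0 := D.semigroupL2_nonneg t hf0
  have key : ∀ n, ∫⁻ y, ENNReal.ofReal (D.semigroupL2 t f y) ^ p *
        gaussWeight (ENNReal.ofReal (2 * (T - q * t))) (ENNReal.ofReal (g n y)) ∂μ ≤
      ∫⁻ y, ENNReal.ofReal (f y) ^ p *
        gaussWeight (ENNReal.ofReal (2 * T)) (ENNReal.ofReal (g n y)) ∂μ := by
    intro n
    obtain ⟨R, hR⟩ := hgR n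
    have h1 := D.semigroupL2_weighted_le t hp hq hC hf0 hfC hfi (g n) hR (hgΓ n) hT
    have hgc : Continuous (g n) := (g n).contMDiff.continuous
    have hi : Integrable (fun z => f z ^ p * Real.exp (-(g n z ^ 2 / (2 * T)))) μ :=
      integrable_rpow_mul_exp hp hfi hf0 hfC (by fun_prop) fun z => neg_nonpos.2 (by positivity)
    rw [ofReal_integral_eq_lintegral_ofReal hi (by
      filter_upwards [hf0] with z hz
      exact mul_nonneg (Real.rpow_nonneg hz _) (Real.exp_pos _).le)] at h1
    refine le_trans (le_of_eq (lintegral_congr_ae ?_)) (h1.trans (le_of_eq (lintegral_congr_ae ?_)))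
    · filter_upwards [hP0] with z hz using hreal hz (hg0 n z) (by positivity)
    · filter_upwards [hf0] with z hz using (hreal hz (hg0 n z) (by positivity)).symm
  have hfin : ∫⁻ y, ENNReal.ofReal (f y) ^ p ∂μ ≠ ⊤ := by
    have hi : Integrable (fun z => f z ^ p * Real.exp ((0 : ℝ))) μ :=
      integrable_rpow_mul_exp (η := fun _ => 0) hp hfi hf0 hfC continuous_const fun z => le_rfl
    have h2 := hi.lintegral_lt_top.ne
    refine ne_of_eq_of_ne (lintegral_congr_ae ?_) h2
    filter_upwards [hf0] with z hz
    rw [Real.exp_zero, mul_one, ENNReal.ofReal_rpow_of_nonneg hz hp0.le]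
  calc _ = ∫⁻ y, liminf (fun n => ENNReal.ofReal (D.semigroupL2 t f y) ^ p *
        gaussWeight (ENNReal.ofReal (2 * (T - q * t))) (ENNReal.ofReal (g n y))) atTop ∂μ :=
        lintegral_congr fun y => (hlim _ (by positivity) y).liminf_eq.symm
    _ ≤ liminf (fun n => ∫⁻ y, ENNReal.ofReal (D.semigroupL2 t f y) ^ p *
        gaussWeight (ENNReal.ofReal (2 * (T - q * t))) (ENNReal.ofReal (g n y)) ∂μ) atTop :=
        lintegral_liminf_le' (hmeas _ _ (by positivity))
    _ ≤ liminf (fun n => ∫⁻ y, ENNReal.ofReal (f y) ^ p *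
        gaussWeight (ENNReal.ofReal (2 * T)) (ENNReal.ofReal (g n y)) ∂μ) atTop :=
        liminf_le_liminf (Eventually.of_forall key)
    _ = _ := by
        refine (tendsto_lintegral_of_dominated_convergence' _ (hmeas f _ (by positivity))
          (fun n => ae_of_all _ fun y => ?_) hfin
          (ae_of_all _ fun y => hlim f (by positivity) y)).liminf_eq
        exact mul_le_of_le_one_right zero_le (gaussWeight_le_one _ _)

end Limit

end SymmetricDiffusion

theorem lemma4p1 {E : Type*} [NormedAddCommGroup E] [NormedSpace ℝ E] [FiniteDimensional ℝ E]
    {M : Type*} [TopologicalSpace M] [ChartedSpace E M] [IsManifold 𝓘(ℝ, E) ∞ M]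
    [T2Space M] [SigmaCompactSpace M] [MeasurableSpace M] [BorelSpace M]
    (μ : Measure M) [IsFiniteMeasureOnCompacts μ] (D : SymmetricDiffusion E μ)
    (x : M) (T p q : ℝ) (hT : 0 < T) (hp : 1 < p) (hq : q = p / (2 * (p - 1)))
    (f : M → ℝ) (hf : MemLp f ∞ μ) (hf0 : 0 ≤ᵐ[μ] f) (t : ℝ≥0) (ht : (t : ℝ) < T / q) :
    ∫⁻ y, D.semigroup t f hf y ^ p * EReal.exp (D.eta x T q t y) ∂μ ≤
      ∫⁻ y, ENNReal.ofReal (f y) ^ p *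
        EReal.exp (-((D.dist x y ^ 2 / ENNReal.ofReal (2 * T) : ℝ≥0∞) : EReal)) ∂μ := by
  have hp0 : 0 < p := by linarith
  have hp1 : 0 < p - 1 := by linarith
  have hq0 : 0 < q := by rw [hq]; positivity
  have hTq : 0 < T - q * t := by
    rw [lt_div_iff₀ hq0] at ht
    linarith
  set K : ℕ → Set M := compactCovering M
  have hK : ∀ n, IsCompact (K n) := isCompact_compactCovering M
  set v : ℕ → Lp ℝ 2 μ := fun n => (SymmetricDiffusion.memLp_two_indicator hf (hK n)).toLp _ with hv
  have hvae : ∀ n, v n =ᵐ[μ] (K n).indicator f := fun n => MemLp.coeFn_toLp _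
  set C : ℝ := (eLpNorm f ∞ μ).toReal
  have hfC : ∀ᵐ z ∂μ, f z ≤ C := by
    filter_upwards [ae_le_eLpNormEssSup (f := f) (μ := μ)] with z hz
    rw [← eLpNorm_exponent_top] at hz
    have := (ENNReal.toReal_le_toReal enorm_ne_top hf.2.ne).2 hz
    rw [toReal_enorm] at this
    exact (le_abs_self _).trans this
  have hC : 0 ≤ C := ENNReal.toReal_nonneg
  have hv0 : ∀ n, ∀ᵐ z ∂μ, 0 ≤ v n z := fun n => by
    filter_upwards [hvae n, hf0] with z h1 h2
    rw [h1]
    exact Set.indicator_apply_nonneg fun _ => h2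
  have hvf : ∀ n, ∀ᵐ z ∂μ, v n z ≤ f z := fun n => by
    filter_upwards [hvae n, hf0] with z h1 h2
    rw [h1]
    exact Set.indicator_apply_le' (fun _ => le_rfl) fun _ => h2
  have hvC : ∀ n, ∀ᵐ z ∂μ, v n z ≤ C := fun n => by
    filter_upwards [hvf n, hfC] with z h1 h2 using h1.trans h2
  have hvi : ∀ n, Integrable (v n) μ := fun n => by
    have : IsFiniteMeasure (μ.restrict (K n)) := ⟨by simpa using (hK n).measure_lt_top⟩
    refine Integrable.congr ?_ (hvae n).symm
    rw [← memLp_one_iff_integrable]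
    exact (memLp_indicator_iff_restrict (hK n).measurableSet).2
      ((hf.restrict (K n)).mono_exponent le_top)
  have hvmono : ∀ n, ∀ᵐ z ∂μ, v n z ≤ v (n + 1) z := fun n => by
    filter_upwards [hvae n, hvae (n + 1), hf0] with z h1 h2 h3
    rw [h1, h2]
    by_cases hz : z ∈ K n
    · rw [Set.indicator_of_mem hz,
        Set.indicator_of_mem (compactCovering_subset M n.le_succ hz)]
    · rw [Set.indicator_of_notMem hz]
      exact Set.indicator_apply_nonneg fun _ => h3
  set w : M → ℝ≥0∞ := fun y => gaussWeight (ENNReal.ofReal (2 * (T - q * t))) (D.dist x y) with hw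
  have hwm : Measurable w :=
    (continuous_gaussWeight (ENNReal.ofReal_pos.2 (by positivity)).ne').measurable.comp
      (D.measurable_dist x)
  have e1 : ∀ y, D.semigroup t f hf y ^ p * EReal.exp (D.eta x T q t y) =
      ⨆ n, ENNReal.ofReal (D.semigroupL2 t (v n) y) ^ p * w y := fun y => by
    change (⨆ n, ENNReal.ofReal (D.semigroupL2 t (v n) y)) ^ p * w y = _
    rw [← ENNReal.iSup_mul]
    congr 1
    exact (ENNReal.orderIsoRpow p hp0).map_iSup _
  rw [lintegral_congr e1, lintegral_iSup' (fun n => ?_) ?_]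
  · refine iSup_le fun n => ?_
    refine (D.lintegral_semigroupL2_le x t hp hq hC (hv0 n) (hvC n) (hvi n) hT hTq).trans ?_
    refine lintegral_mono_ae ?_
    filter_upwards [hvf n] with z hz
    exact mul_le_mul_left (ENNReal.rpow_le_rpow (ENNReal.ofReal_le_ofReal hz) hp0.le) _
  · have hall : ∀ᵐ z ∂μ, ∀ n, D.semigroupL2 t (v n) z ≤ D.semigroupL2 t (v (n + 1)) z :=
      ae_all_iff.2 fun n => D.semigroupL2_mono t (hvmono n)
    filter_upwards [hall] with z hz
    refine monotone_nat_of_le_succ fun n => ?_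
    exact mul_le_mul_left (ENNReal.rpow_le_rpow (ENNReal.ofReal_le_ofReal (hz n)) hp0.le) _
  · exact ((Lp.aestronglyMeasurable _).aemeasurable.ennreal_ofReal.pow_const p).mul hwm.aemeasurable
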